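/- Let $m\ge 0$ and consider on $\mathbb R^d$ the problem $$\min_x\ \psi_0(x)\quad\text{s.t.}\quad \psi_i(x)\le\eta_i,\ i=1,\dots,m,\qquad \psi_i=f_i+\chi_i,\quad f_i=g_i-h_i\quad(0\le i\le m),$$ where $\chi_0$ is proper, convex and lower semicontinuous with values in $(-\infty,+\infty]$; $\chi_1,\dots,\chi_m$ are convex and continuous on $\operatorname{dom}\chi_0$; $h_i$ is convex and differentiable with $L_{h_i}$-Lipschitz gradient; and $g_i(x)=\max_{y\in\mathcal Y_i}\langle A_ix,y\rangle-p_i(y)$ with $A_i$ linear, $\mathcal Y_i$ nonempty, convex and compact, and $p_i:\mathcal Y_i\to\mathbb R$ convex and continuous. Let $\hat y_i=\arg\min_{y\in\mathcal Y_i}\|y\|$, $D_i=\max_{y\in\mathcal Y_i}\|y-\hat y_i\|$, $c_i=\|A_i\|^2D_i^2$, $c=(c_1,\dots,c_m)$. For $\beta_i>0$ let $g_i^{\beta}(x)=\max_{y\in\mathcal Y_i}\langle A_ix,y\rangle-p_i(y)-\frac{\beta_i}2\|y-\hat y_i\|^2$, $f_i^\beta=g_i^\beta-h_i$, $\psi_i^\beta=f_i^\beta+\chi_i$,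 $L_i=\max\{\|A_i\|^2/\beta_i,\,L_{h_i}\}$. The smoothed problem is to minimize $\psi^\beta_0$ subject to $\psi_i^\beta\le\eta_i$ $(1\le i\le m)$. *Method (LCPG on the smoothed problem).* Let $x^0\in\operatorname{dom}\chi_0$ and $\psi_i(x^0)<\eta_i^0<\eta_i$ for $1\le i\le m$. For $k=0,\dots,K$, $x^{k+1}$ minimizes $\psi_0^k(x)$ subject to $\psi_i^k(x)\le\eta_i^k$ $(1\le i\le m)$, where $\psi_i^k(x)=f_i^\beta(x^k)+\langle\nabla f_i^\beta(x^k),x-x^k\rangle+\frac{L_i}2\|x-x^k\|^2+\chi_i(x)$, and $\eta^{k+1}=\eta^k+\delta^k$ with $\delta^k=\frac{\eta-\eta^0}{(k+1)(k+2)}$. A multiplier vector of the $k$-th subproblem is a $\lambda^{k+1}\in\mathbb R^m_+$ with $0\in\partial\psi_0^k(x^{k+1})+\sum_{i=1}^m\lambda_i^{k+1}\partial\psi_i^k(x^{k+1})$ and $\lambda_i^{k+1}(\psi_i^k(x^{k+1})-\eta_i^k)=0$ for all $i$. The output is $x^{\hat k+1}$, where $\hat k\in\{0,\dots,K\}$ is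 random with $P(\hat k=k)=(k+1)/\sum_{j=0}^K(j+1)$. *Approximate KKT points.* $\partial^\nu g$ denotes the set of $v$ with $g(z)\ge g(x)+\langle v,z-x\rangle-\nu$ for all $z$, and $\partial^\nu\psi_i(x)=\partial^\nu g_i(x)+\{-\nabla h_i(x)\}+\partial\chi_i(x)$. A random point $x$ is a randomized type-III $(\epsilon,\nu)$-KKT point of the original problem if there is a random $\lambda\ge0$ with $\mathbb E\,\mathrm{dist}\bigl(0,\partial^\nu\psi_0(x)+\sum_i\lambda_i\partial^\nu\psi_i(x)\bigr)^2\le\epsilon$, $\mathbb E\sum_i\lambda_i|\psi_i(x)-\eta_i|\le\epsilon$ and $\mathbb E\sum_i[\psi_i(x)-\eta_i]_+\le\epsilon$. Here the subdifferential of $\chi_i$ is that of the function equal to $\chi_i$ on $\operatorname{dom}\chi_0$ and $+\infty$ elsewhere, and summands with $\lambda_i=0$ are omitted. **Theorem.** (1) For every $\kappa>0$ there is a constant $C$ depending only on $\kappa$ such that the following holds. Assume $c_0>0$, $\nu=\beta_iD_i^2/2$ and $\nu L_{h_i}\le\kappa c_i$ for $i=0,\dots,m$. Then every subproblem has a multiplier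 vector. If multipliers $\lambda^{k+1}$ $(0\le k\le K)$ satisfy $\|\lambda^{k+1}\|_1\le B$, and $x^*$ is an optimal solution of the smoothed problem and $\Delta=\psi_0(x^0)-\psi_0(x^*)$, then $x^{\hat k+1}$ is a randomized type-III $(\bar\epsilon,\nu)$-KKT point of the original problem with $$\bar\epsilon=C\left\{\frac2{K+2}\left[\left(\frac{8(c_0+B\|c\|)^2}{c_0\nu}+\frac{2B\|c\|}{c_0}\right)(\Delta+\nu)+B\|\eta-\eta^0\|\right]+B\nu+m\nu\right\}.$$ (2) Consequently the gradient complexity is $O(1/\epsilon^2)$: given the problem with $c_0>0$ (and $L_{h_i}=0$ whenever $c_i=0$), $\eta^0$, $B\ge 0$ and $\bar\Delta\ge0$, there are $C,\epsilon_0>0$ such that for every $\epsilon\in(0,\epsilon_0]$ one can choose $\nu\in(0,\epsilon]$ and $K$ so that iterations $0,\dots,K$ make at most $C/\epsilon^2$ evaluations of $(f_i^\beta,\nabla f_i^\beta)$, and, whenever $\nu=\beta_iD_i^2/2$ for all $i$, the multipliers are bounded by $B$ as above and $\Delta\le\bar\Delta$, the output is a randomized type-III $(\epsilon,\nu)$-KKT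 point of the original problem. -/

import Mathlib

open MeasureTheory
open scoped Pointwise ENNReal

noncomputable section

/-- Euclidean space of dimension `n`. -/
abbrev Vec (n : ℕ) : Type := EuclideanSpace ℝ (Fin n)

/-- The `ν`-subdifferential at `x` of the convex function equal to `φ` on `D` and to `+∞` off `D`;
it is empty off `D`, and `ν = 0` gives the ordinary convex subdifferential. -/
def epsSubdiff {d : ℕ} (D : Set (Vec d)) (ν : ℝ) (φ : Vec d → ℝ) (x : Vec d) : Set (Vec d) :=
  {v | x ∈ D ∧ ∀ z ∈ D, φ x + inner ℝ v (z - x) - ν ≤ φ z}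

/-- The Minkowski sum `S₀ + ∑ⱼ λⱼ Sⱼ`, where a term with zero multiplier is `{0}`
(which is `0 • Sⱼ` for every nonempty `Sⱼ`). -/
def weightedSum {d m : ℕ} (S : Fin (m + 1) → Set (Vec d)) (lam : Fin m → ℝ) : Set (Vec d) :=
  S 0 + ∑ j : Fin m, (if lam j = 0 then {0} else lam j • S j.succ)

/-- The problem `min ψ₀(x)` subject to `ψⱼ(x) ≤ ηⱼ`, with `ψᵢ = gᵢ - hᵢ + χᵢ` and
`gᵢ(x) = max_{y ∈ Yᵢ} ⟪Aᵢ x, y⟫ - pᵢ(y)`.  The index `0` is the objective and `j.succ` is the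
`j`-th constraint. -/
structure DCProblem (d m : ℕ) where
  a : Fin (m + 1) → ℕ
  A : ∀ i, Vec d →L[ℝ] Vec (a i)
  Y : ∀ i, Set (Vec (a i))
  p : ∀ i, Vec (a i) → ℝ
  h : Fin (m + 1) → Vec d → ℝ
  Lh : Fin (m + 1) → ℝ
  chi0 : Vec d → EReal
  chi : Fin m → Vec d → ℝ
  eta : Fin m → ℝ
  Y_convex : ∀ i, Convex ℝ (Y i)
  Y_compact : ∀ i, IsCompact (Y i)
  Y_nonempty : ∀ i, (Y i).Nonempty
  p_convex : ∀ i, ConvexOn ℝ (Y i) (p i)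
  p_continuous : ∀ i, ContinuousOn (p i) (Y i)
  h_convex : ∀ i, ConvexOn ℝ Set.univ (h i)
  h_differentiable : ∀ i, Differentiable ℝ (h i)
  Lh_nonneg : ∀ i, 0 ≤ Lh i
  h_smooth : ∀ i x y, ‖gradient (h i) x - gradient (h i) y‖ ≤ Lh i * ‖x - y‖
  chi0_ne_bot : ∀ x, chi0 x ≠ ⊥
  chi0_proper : ∃ x, chi0 x < ⊤
  chi0_convex : ConvexOn ℝ {x | chi0 x < ⊤} (fun x => (chi0 x).toReal)
  chi0_lsc : LowerSemicontinuous chi0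
  chi_convex : ∀ j, ConvexOn ℝ {x | chi0 x < ⊤} (chi j)
  chi_continuous : ∀ j, ContinuousOn (chi j) {x | chi0 x < ⊤}

namespace DCProblem

variable {d m : ℕ} (P : DCProblem d m)

/-- The effective domain of `χ₀`. -/
def dom : Set (Vec d) := {x | P.chi0 x < ⊤}

/-- `χᵢ` as a real function; for `i = 0` this is meaningful on `dom χ₀`. -/
def chiReal (i : Fin (m + 1)) (x : Vec d) : ℝ :=
  Fin.cases (P.chi0 x).toReal (fun j => P.chi j x) i

/-- The max-type function `gᵢ`. -/
def g (i : Fin (m + 1)) (x : Vec d) : ℝ :=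
  sSup ((fun y => inner ℝ (P.A i x) y - P.p i y) '' P.Y i)

/-- `ψᵢ = gᵢ - hᵢ + χᵢ`. -/
def psi (i : Fin (m + 1)) (x : Vec d) : ℝ := P.g i x - P.h i x + P.chiReal i x

/-- The element of `Yᵢ` of least norm. -/
def yhat (i : Fin (m + 1)) : Vec (P.a i) :=
  Classical.epsilon fun y => y ∈ P.Y i ∧ ∀ z ∈ P.Y i, ‖y‖ ≤ ‖z‖

/-- `max_{y ∈ Yᵢ} ‖y - ŷᵢ‖`. -/
def D (i : Fin (m + 1)) : ℝ := sSup ((fun y => ‖y - P.yhat i‖) '' P.Y i)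

/-- `cᵢ = ‖Aᵢ‖² Dᵢ²`, with the operator norm. -/
def c (i : Fin (m + 1)) : ℝ := ‖P.A i‖ ^ 2 * P.D i ^ 2

/-- Euclidean norm of `(c₁, …, c_m)`. -/
def cNorm : ℝ := ‖(WithLp.toLp 2 (fun j : Fin m => P.c j.succ) : Vec m)‖

/-! Nesterov smoothing with parameters `β`. -/

def gSmooth (β : Fin (m + 1) → ℝ) (i : Fin (m + 1)) (x : Vec d) : ℝ :=
  sSup ((fun y => inner ℝ (P.A i x) y - P.p i y - β i / 2 * ‖y - P.yhat i‖ ^ 2) '' P.Y i)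

def fSmooth (β : Fin (m + 1) → ℝ) (i : Fin (m + 1)) (x : Vec d) : ℝ :=
  P.gSmooth β i x - P.h i x

def psiSmooth (β : Fin (m + 1) → ℝ) (i : Fin (m + 1)) (x : Vec d) : ℝ :=
  P.fSmooth β i x + P.chiReal i x

/-- The Lipschitz modulus `max {‖Aᵢ‖² / βᵢ, L_{hᵢ}}` of the gradient of the smoothed function. -/
def Lip (β : Fin (m + 1) → ℝ) (i : Fin (m + 1)) : ℝ := max (‖P.A i‖ ^ 2 / β i) (P.Lh i)

/-- `x` is an optimal solution of the smoothed problem. -/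
def IsOptimalSmoothed (β : Fin (m + 1) → ℝ) (x : Vec d) : Prop :=
  (x ∈ P.dom ∧ ∀ j : Fin m, P.psiSmooth β j.succ x ≤ P.eta j) ∧
  ∀ z ∈ P.dom, (∀ j : Fin m, P.psiSmooth β j.succ z ≤ P.eta j) →
    P.psiSmooth β 0 x ≤ P.psiSmooth β 0 z

/-! The level constrained proximal gradient method on the smoothed problem. -/

/-- The first-order oracle: value and gradient of the `i`-th smoothed function at `x`. -/
def oracle (β : Fin (m + 1) → ℝ) (i : Fin (m + 1)) (x : Vec d) : ℝ × Vec d :=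
  (P.fSmooth β i x, gradient (P.fSmooth β i) x)

/-- The surrogate of the `i`-th smoothed function at the centre `xk`; it reads the smoothed
function only through one oracle answer at `xk`. -/
def surrogate (β : Fin (m + 1) → ℝ) (xk : Vec d) (i : Fin (m + 1)) (x : Vec d) : ℝ :=
  (P.oracle β i xk).1 + inner ℝ (P.oracle β i xk).2 (x - xk)
    + P.Lip β i / 2 * ‖x - xk‖ ^ 2 + P.chiReal i x

/-- The subdifferential of the surrogate: gradient of its smooth part plus `∂χᵢ`. -/
def surrogateSubdiff (β : Fin (m + 1) → ℝ) (xk x : Vec d) (i : Fin (m + 1)) : Set (Vec d) :=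
  {(P.oracle β i xk).2 + P.Lip β i • (x - xk)} + epsSubdiff P.dom 0 (P.chiReal i) x

/-- The levels `η⁰, ηᵏ⁺¹ = ηᵏ + δᵏ` with `δᵏ = (η - η⁰) / ((k + 1) (k + 2))`. -/
def level (eta0 : Fin m → ℝ) : ℕ → Fin m → ℝ
  | 0 => eta0
  | k + 1 => fun j =>
      level eta0 k j + (P.eta j - eta0 j) / (((k : ℝ) + 1) * ((k : ℝ) + 2))

/-- `x` solves the subproblem with centre `xk` and levels `lev`. -/
def IsSubproblemSolution (β : Fin (m + 1) → ℝ) (lev : Fin m → ℝ) (xk x : Vec d) : Prop :=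
  (x ∈ P.dom ∧ ∀ j : Fin m, P.surrogate β xk j.succ x ≤ lev j) ∧
  ∀ z ∈ P.dom, (∀ j : Fin m, P.surrogate β xk j.succ z ≤ lev j) →
    P.surrogate β xk 0 x ≤ P.surrogate β xk 0 z

/-- `lam` is a vector of Lagrange multipliers at the point `x` of the subproblem with centre `xk`
and levels `lev`. -/
def IsMultiplier (β : Fin (m + 1) → ℝ) (lev : Fin m → ℝ) (xk x : Vec d) (lam : Fin m → ℝ) : Prop :=
  (∀ j, 0 ≤ lam j) ∧
  0 ∈ weightedSum (P.surrogateSubdiff β xk x) lam ∧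
  ∀ j : Fin m, lam j * (P.surrogate β xk j.succ x - lev j) = 0

/-- `x 0, …, x (K + 1)` are iterates of the method (iterations `k = 0, …, K`), started at a
strictly feasible point of the original problem. -/
structure IsRun (β : Fin (m + 1) → ℝ) (eta0 : Fin m → ℝ) (K : ℕ) (x : ℕ → Vec d) : Prop where
  start_dom : x 0 ∈ P.dom
  start_strict : ∀ j : Fin m, P.psi j.succ (x 0) < eta0 j
  level_lt : ∀ j : Fin m, eta0 j < P.eta j
  step : ∀ k ≤ K, P.IsSubproblemSolution β (P.level eta0 k) (x k) (x (k + 1))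

/-- `lam (k + 1)` is, for every iteration `k ≤ K`, a vector of multipliers of the `k`-th
subproblem whose `ℓ¹` norm is at most `B`. -/
def BoundedMultipliers (β : Fin (m + 1) → ℝ) (eta0 : Fin m → ℝ) (K : ℕ) (x : ℕ → Vec d)
    (lam : ℕ → Fin m → ℝ) (B : ℝ) : Prop :=
  ∀ k ≤ K, P.IsMultiplier β (P.level eta0 k) (x k) (x (k + 1)) (lam (k + 1)) ∧
    ∑ j : Fin m, |lam (k + 1) j| ≤ B

/-- The oracle queries made in the iterations `0, …, K`: each iteration queries each of the `m + 1`
smoothed functions once, at the current point. -/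
def queries (K : ℕ) (x : ℕ → Vec d) : List (Fin (m + 1) × Vec d) :=
  (List.range (K + 1)).flatMap fun k => (List.finRange (m + 1)).map fun i => (i, x k)

/-! Approximate KKT points of the original problem. -/

/-- `∂^ν ψᵢ(x) = ∂^ν gᵢ(x) + {-∇hᵢ(x)} + ∂χᵢ(x)`. -/
def psiSubdiff (ν : ℝ) (x : Vec d) (i : Fin (m + 1)) : Set (Vec d) :=
  epsSubdiff Set.univ ν (P.g i) x + {-gradient (P.h i) x} + epsSubdiff P.dom 0 (P.chiReal i) x

/-- Squared distance from `0` to `∂^ν ψ₀(x) + ∑ⱼ λⱼ ∂^ν ψⱼ(x)` (`∞` if that set is empty). -/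
def stationarity (ν : ℝ) (x : Vec d) (lam : Fin m → ℝ) : ℝ≥0∞ :=
  Metric.infEDist 0 (weightedSum (P.psiSubdiff ν x) lam) ^ 2

/-- `X` is a randomized type-III `(ε, ν)`-KKT point: there are random multipliers `Λ ≥ 0` for which
the stationarity, complementary slackness and feasibility residuals are at most `ε` in
expectation. -/
def IsRandomizedTypeIII {Ω : Type*} [MeasurableSpace Ω] (μ : Measure Ω) (X : Ω → Vec d)
    (ε ν : ℝ) : Prop :=
  ∃ Lam : Ω → Fin m → ℝ, Measurable X ∧ Measurable Lam ∧ (∀ ω j, 0 ≤ Lam ω j) ∧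
    Measurable (fun ω => P.stationarity ν (X ω) (Lam ω)) ∧
    Measurable (fun ω => ∑ j : Fin m, Lam ω j * |P.psi j.succ (X ω) - P.eta j|) ∧
    Measurable (fun ω => ∑ j : Fin m, max (P.psi j.succ (X ω) - P.eta j) 0) ∧
    ∫⁻ ω, P.stationarity ν (X ω) (Lam ω) ∂μ ≤ ENNReal.ofReal ε ∧
    ∫⁻ ω, ENNReal.ofReal (∑ j : Fin m, Lam ω j * |P.psi j.succ (X ω) - P.eta j|) ∂μ
      ≤ ENNReal.ofReal ε ∧
    ∫⁻ ω, ENNReal.ofReal (∑ j : Fin m, max (P.psi j.succ (X ω) - P.eta j) 0) ∂μ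
      ≤ ENNReal.ofReal ε

/-- The expression inside the `O(·)` of the rate. -/
def rate (eta0 : Fin m → ℝ) (K : ℕ) (ν B Δ : ℝ) : ℝ :=
  2 / ((K : ℝ) + 2) *
      ((8 * (P.c 0 + B * P.cNorm) ^ 2 / (P.c 0 * ν) + 2 * B * P.cNorm / P.c 0) * (Δ + ν)
        + B * ‖(WithLp.toLp 2 (fun j => P.eta j - eta0 j) : Vec m)‖)
    + B * ν + m * ν

end DCProblem

/-- `khat` is a random index in `{0, …, K}` with `P(khat = k) = (k + 1) / ∑ⱼ (j + 1)`. -/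
def IsRandomIndex {Ω : Type*} [MeasurableSpace Ω] (μ : Measure Ω) (K : ℕ)
    (khat : Ω → Fin (K + 1)) : Prop :=
  Measurable khat ∧ ∀ k : Fin (K + 1),
    μ (khat ⁻¹' {k}) = ENNReal.ofReal (((k : ℝ) + 1) / ∑ j : Fin (K + 1), ((j : ℝ) + 1))

end

/-! Nesterov smoothing costs at most `ν`: the penalty takes values in `[0, ν]`, so `gSmooth ≤ g ≤
gSmooth + ν`, and every gradient of `gSmooth` is a `ν`-subgradient of `g`. Danskin's argument
(`gSmooth_expansion`) gives that gradient the Lipschitz modulus `‖A‖² / β = c / (2ν)`.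

Each surrogate majorizes its smoothed function and touches it at the centre. Since the levels
strictly increase, every iterate is a Slater point of the next subproblem, and convex duality
produces multipliers (`exists_isMultiplier`). Testing the strongly convex subproblem at its centre
yields a decrease of `Lip 0 / 2` times the squared step. Summed with weights `k + 1`, and using `Lip
0 ≥ c 0 / (2ν)`, this bounds the weighted sum of squared steps by `4ν / c 0 * (K + 1) * (Δ + ν)`.

All residuals at `x (k + 1)` are controlled by the step. Moving the gradients from the old point to
the new one costs `3 * Lip i * ‖step‖` per function. Complementary slackness is exact for the
surrogate and the current level, so the error is surrogate gap, smoothing gap and level gap.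
Infeasibility is at most `ν`. Averaging with the law of the random index
(`IsRandomIndex.lintegral_le`) and `Lip i ≤ (κ + 1) * c i / ν` gives the rate. Taking `ν`
proportional to `ε` and `K` to `ε⁻²` gives the complexity. -/

/-! ### Separation, the subdifferential sum rule and Lagrange multipliers. -/

section ConvexAnalysis

/-- Sandwich form of the subdifferential sum rule on a convex set with nonempty interior. -/
theorem ConvexOn.exists_dual_of_isMinOn_add {E : Type*} [NormedAddCommGroup E] [NormedSpace ℝ E]
    [FiniteDimensional ℝ E] {D : Set E} {F G : E → ℝ} (hF : ConvexOn ℝ D F) (hG : ConvexOn ℝ D G)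
    {x : E} (hx : x ∈ D) (hD : (interior D).Nonempty)
    (hmin : ∀ z ∈ D, F x + G x ≤ F z + G z) :
    ∃ l : StrongDual ℝ E, (∀ z ∈ D, F x + l (z - x) ≤ F z) ∧ ∀ z ∈ D, G x - l (z - x) ≤ G z := by
  obtain ⟨z₀, hz₀⟩ := hD
  -- Minimality of `x` says that the graph of `F` lies above that of `F x + G x - G`. Restricting
  -- the strict epigraph to the interior makes it open, as the separation theorem requires.
  set U : Set (E × ℝ) := {p | p.1 ∈ interior D ∧ F p.1 < p.2} with hU
  set W : Set (E × ℝ) := {p | p.1 ∈ D ∧ p.2 ≤ F x + G x - G p.1} with hW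
  have hUc : Convex ℝ U :=
    (hF.subset interior_subset hF.1.interior).convex_strict_epigraph
  have hWc : Convex ℝ W := by
    have h := (hG.neg.add_const (F x + G x)).convex_hypograph
    convert h using 3
    simp [sub_eq_neg_add]
  have hUo : IsOpen U := by
    rw [isOpen_iff_mem_nhds]
    rintro ⟨z, t⟩ ⟨hz, ht⟩
    have hc : ContinuousAt F z := hF.continuousOn_interior.continuousAt (isOpen_interior.mem_nhds hz)
    have h1 : ∀ᶠ p : E × ℝ in nhds (z, t), p.1 ∈ interior D :=
      continuousAt_fst.eventually (isOpen_interior.mem_nhds hz)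
    have h2 : ∀ᶠ p : E × ℝ in nhds (z, t), F p.1 < p.2 :=
      (ContinuousAt.comp (f := Prod.fst) (g := F) (x := (z, t)) hc continuousAt_fst).eventually_lt
        continuousAt_snd ht
    exact h1.and h2
  have hdisj : Disjoint U W := by
    rw [Set.disjoint_left]
    rintro ⟨z, t⟩ ⟨_, h2⟩ ⟨h3, h4⟩
    have := hmin z h3
    simp only at h2 h4
    linarith
  obtain ⟨f, u, hfU, hfW⟩ := geometric_hahn_banach_open hUc hUo hWc hdisj
  set l : StrongDual ℝ E := f.comp (ContinuousLinearMap.inl ℝ E ℝ) with hl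
  set a : ℝ := f (0, 1) with ha
  have hf : ∀ z t, f (z, t) = l z + a * t := by
    intro z t
    have : ((z, t) : E × ℝ) = (z, 0) + t • (0, 1) := by simp
    rw [this, map_add, map_smul, smul_eq_mul, mul_comm]
    rfl
  have hz₀D : z₀ ∈ D := interior_subset hz₀
  -- The separating hyperplane is not vertical: over the interior point `z₀` both sets have points,
  -- the one of `U` chosen strictly higher.
  have ha0 : a < 0 := by
    have h1 := hfU (z₀, F z₀ + 1 + |F x + G x - G z₀ - F z₀|)
      ⟨hz₀, by have := abs_nonneg (F x + G x - G z₀ - F z₀); simp only; linarith⟩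
    have h2 := hfW (z₀, F x + G x - G z₀) ⟨hz₀D, le_rfl⟩
    rw [hf] at h1 h2
    have h3 := le_abs_self (F x + G x - G z₀ - F z₀)
    by_contra hcon
    push Not at hcon
    nlinarith
  have hint : ∀ z ∈ interior D, l z + a * F z ≤ u := by
    intro z hz
    refine le_of_forall_pos_le_add fun e he => ?_
    have h1 := hfU (z, F z + e / (-a)) ⟨hz, by simp only; have := div_pos he (neg_pos.2 ha0); linarith⟩
    rw [hf] at h1
    have h2 : a * (e / (-a)) = -e := by
      rw [div_neg, mul_neg, mul_div_cancel₀ _ ha0.ne]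
    linarith [mul_add a (F z) (e / (-a))]
  -- Boundary points are reached along the segment to `z₀`, whose points other than `z` are
  -- interior; convexity of `F` replaces continuity.
  have hall : ∀ z ∈ D, l z + a * F z ≤ u := by
    intro z hz
    set q : ℝ := l z + a * F z with hq
    set q₀ : ℝ := l z₀ + a * F z₀ with hq₀
    have hseg : ∀ s : ℝ, 0 < s → s ≤ 1 → (1 - s) * q + s * q₀ ≤ u := by
      intro s hs hs1
      have hmem : (1 - s) • z + s • z₀ ∈ interior D := by
        rw [add_comm]
        exact hF.1.combo_interior_self_mem_interior hz₀ hz hs (by linarith) (by ring)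
      have h1 := hint _ hmem
      have h2 := hF.2 hz hz₀D (by linarith : (0 : ℝ) ≤ 1 - s) hs.le (by ring)
      simp only [smul_eq_mul] at h2
      rw [map_add, map_smul, map_smul, smul_eq_mul, smul_eq_mul] at h1
      nlinarith [mul_le_mul_of_nonpos_left h2 ha0.le]
    by_contra hcon
    push Not at hcon
    have h1 := hseg 1 one_pos le_rfl
    have hd : 0 < q - q₀ := by linarith
    have h2 := hseg ((q - u) / (2 * (q - q₀))) (by apply div_pos <;> linarith)
      (by rw [div_le_one (by linarith)]; linarith)
    have h3 : (q - u) / (2 * (q - q₀)) * (q - q₀) = (q - u) / 2 := by field_simp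
    nlinarith
  have hlow : ∀ z ∈ D, u ≤ l z + a * (F x + G x - G z) := by
    intro z hz
    have := hfW (z, F x + G x - G z) ⟨hz, le_rfl⟩
    rwa [hf] at this
  -- The two bounds meet at `x`, so `u = l x + a * F x`; dividing by `-a` normalizes the slope.
  have hu1 := hall x hx
  have hu2 := hlow x hx
  have hna : 0 < -a := neg_pos.2 ha0
  refine ⟨(-a)⁻¹ • l, fun z hz => ?_, fun z hz => ?_⟩
  · have h := hall z hz
    have h4 : ((-a)⁻¹ • l) (z - x) = (l z - l x) / (-a) := by
      simp [div_eq_inv_mul]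
    rw [h4, ← le_sub_iff_add_le', div_le_iff₀ hna]
    nlinarith
  · have h := hlow z hz
    have h4 : ((-a)⁻¹ • l) (z - x) = (l z - l x) / (-a) := by
      simp [div_eq_inv_mul]
    rw [h4, sub_le_comm, le_div_iff₀ hna]
    nlinarith

theorem ConvexOn.finset_sum {E ι : Type*} [AddCommGroup E] [Module ℝ E] {s : Finset ι} {D : Set E}
    {F : ι → E → ℝ} (hD : Convex ℝ D) (hF : ∀ i ∈ s, ConvexOn ℝ D (F i)) :
    ConvexOn ℝ D (fun z => ∑ i ∈ s, F i z) := by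
  induction s using Finset.cons_induction with
  | empty => simpa using convexOn_const 0 hD
  | cons b t hb ih =>
    simp only [Finset.sum_cons]
    exact (hF b (Finset.mem_cons_self _ _)).add (ih fun i hi => hF i (Finset.mem_cons_of_mem hi))

variable {E : Type*} [NormedAddCommGroup E] [InnerProductSpace ℝ E] [FiniteDimensional ℝ E]

/-- A convex set has interior relative to its affine hull, which becomes a linear span once `x` is
moved to the origin. This removes the interior assumption from the sum rule. -/
theorem Convex.interior_preimage_span_nonempty {D : Set E} (hD : Convex ℝ D) {x : E} (hx : x ∈ D) :
    (interior {v : Submodule.span ℝ ((fun v => x + v) ⁻¹' D) | x + (v : E) ∈ D}).Nonempty := by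
  set S : Set E := (fun v => x + v) ⁻¹' D with hS
  have hSc : Convex ℝ S := hD.translate_preimage_right x
  set D' : Set (Submodule.span ℝ S) := {v | x + (v : E) ∈ D} with hD'
  have hD'S : D' = ((↑) : Submodule.span ℝ S → E) ⁻¹' S := rfl
  have hc : Convex ℝ D' := hSc.linear_preimage (Submodule.span ℝ S).subtype
  have h0 : (0 : Submodule.span ℝ S) ∈ D' := by simpa [hD'] using hx
  rw [hc.interior_nonempty_iff_affineSpan_eq_top,
    AffineSubspace.affineSpan_eq_top_iff_vectorSpan_eq_top_of_nonempty ℝ _ _ ⟨0, h0⟩,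
    vectorSpan_eq_span_vsub_set_right ℝ h0]
  simp only [vsub_eq_sub, sub_zero, Set.image_id']
  rw [hD'S]
  exact Submodule.span_span_coe_preimage

/-- Sandwich form of the subdifferential sum rule for two finite convex functions on a common
convex set of a finite-dimensional space. -/
theorem ConvexOn.exists_inner_of_isMinOn_add {D : Set E} {F G : E → ℝ} (hF : ConvexOn ℝ D F)
    (hG : ConvexOn ℝ D G) {x : E} (hx : x ∈ D) (hmin : ∀ z ∈ D, F x + G x ≤ F z + G z) :
    ∃ v : E, (∀ z ∈ D, F x + inner ℝ v (z - x) ≤ F z) ∧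
      ∀ z ∈ D, G x - inner ℝ v (z - x) ≤ G z := by
  set V := Submodule.span ℝ ((fun v => x + v) ⁻¹' D) with hV
  set D' : Set V := {v | x + (v : E) ∈ D} with hD'
  have hpre : ∀ {H : E → ℝ}, ConvexOn ℝ D H → ConvexOn ℝ D' (fun v : V => H (x + v)) := by
    intro H hH
    exact (hH.translate_right x).comp_linearMap V.subtype
  obtain ⟨l, h1, h2⟩ := ConvexOn.exists_dual_of_isMinOn_add (x := (0 : V)) (hpre hF) (hpre hG)
    (by simpa [hD'] using hx) (hF.1.interior_preimage_span_nonempty hx)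
    (fun z hz => by simpa using hmin _ hz)
  set w : V := (InnerProductSpace.toDual ℝ V).symm l with hw
  have hmem : ∀ z ∈ D, z - x ∈ V := fun z hz => Submodule.subset_span (by simpa using hz)
  have hl : ∀ z (hz : z ∈ D), l (⟨z - x, hmem z hz⟩ - 0) = inner ℝ (w : E) (z - x) := by
    intro z hz
    rw [sub_zero, ← InnerProductSpace.toDual_symm_apply (𝕜 := ℝ)]
    rfl
  refine ⟨w, fun z hz => ?_, fun z hz => ?_⟩
  · have := h1 ⟨z - x, hmem z hz⟩ (by simpa [hD'] using hz)
    rw [hl z hz] at this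
    simpa using this
  · have := h2 ⟨z - x, hmem z hz⟩ (by simpa [hD'] using hz)
    rw [hl z hz] at this
    simpa using this

/-- The subdifferential sum rule for finitely many convex functions on a common convex set. -/
theorem ConvexOn.exists_inner_of_sum {ι : Type*} (s : Finset ι) {D : Set E} {F : ι → E → ℝ}
    (hD : Convex ℝ D) (hF : ∀ i ∈ s, ConvexOn ℝ D (F i)) {x : E} (hx : x ∈ D) {v : E}
    (hs : s.Nonempty)
    (hv : ∀ z ∈ D, ∑ i ∈ s, F i x + inner ℝ v (z - x) ≤ ∑ i ∈ s, F i z) :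
    ∃ u : ι → E, ∑ i ∈ s, u i = v ∧
      ∀ i ∈ s, ∀ z ∈ D, F i x + inner ℝ (u i) (z - x) ≤ F i z := by
  classical
  induction hs using Finset.Nonempty.cons_induction generalizing v with
  | singleton a =>
    refine ⟨fun _ => v, by simp, fun i hi z hz => ?_⟩
    rw [Finset.mem_singleton] at hi
    subst hi
    simpa using hv z hz
  | cons a s ha hs ih =>
    simp only [Finset.sum_cons] at hv ⊢
    -- Absorbing `-v` into the tail makes `x` a minimizer of a sum of two functions; the slope `w`
    -- of the sandwich goes to `F a`, and `v - w` is left for the tail.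
    have hG : ConvexOn ℝ D (fun z => ∑ i ∈ s, F i z + inner ℝ (-v) z) := by
      refine ConvexOn.add ?_ ?_
      · exact ConvexOn.finset_sum hD fun i hi => hF i (Finset.mem_cons_of_mem hi)
      · exact (innerₛₗ ℝ (-v)).convexOn hD
    obtain ⟨w, hw1, hw2⟩ := ConvexOn.exists_inner_of_isMinOn_add
      (hF a (Finset.mem_cons_self _ _)) hG hx (fun z hz => by
        have := hv z hz
        simp only [inner_neg_left, inner_sub_right] at this ⊢
        linarith)
    obtain ⟨u, hu1, hu2⟩ := ih (fun i hi => hF i (Finset.mem_cons_of_mem hi)) (v := v - w)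
      (fun z hz => by
        have := hw2 z hz
        simp only [inner_neg_left, inner_sub_right, inner_sub_left] at this ⊢
        linarith)
    refine ⟨Function.update u a w, ?_, fun i hi z hz => ?_⟩
    · rw [Function.update_self, Finset.sum_congr rfl (g := u), hu1]
      · abel
      · intro i hi
        exact Function.update_of_ne (ne_of_mem_of_not_mem hi ha) _ _
    · rcases Finset.mem_cons.1 hi with rfl | hi
      · rw [Function.update_self]
        exact hw1 z hz
      · rw [Function.update_of_ne (ne_of_mem_of_not_mem hi ha)]
        exact hu2 i hi z hz

/-- Lagrange multipliers of a convex program under Slater's condition. -/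
theorem ConvexOn.exists_lagrange_multipliers {E : Type*} [AddCommGroup E] [Module ℝ E] {m : ℕ}
    {D : Set E} {F : E → ℝ} {G : Fin m → E → ℝ} (hF : ConvexOn ℝ D F)
    (hG : ∀ j, ConvexOn ℝ D (G j)) {x : E} (hx : x ∈ D) (hfeas : ∀ j, G j x ≤ 0)
    (hmin : ∀ z ∈ D, (∀ j, G j z ≤ 0) → F x ≤ F z) (hslater : ∃ z ∈ D, ∀ j, G j z < 0) :
    ∃ lam : Fin m → ℝ, (∀ j, 0 ≤ lam j) ∧ (∀ j, lam j * G j x = 0) ∧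
      ∀ z ∈ D, F x ≤ F z + ∑ j, lam j * G j z := by
  obtain ⟨z₀, hz₀, hz₀s⟩ := hslater
  -- The values strictly dominated by some point of `D`. Optimality of `x` keeps the origin out, and
  -- the normal of a separating hyperplane supplies the multipliers.
  set U : Set (ℝ × (Fin m → ℝ)) := {r | ∃ z ∈ D, F z - F x < r.1 ∧ ∀ j, G j z < r.2 j} with hU
  have hUo : IsOpen U := by
    have : U = ⋃ z ∈ D, {r : ℝ × (Fin m → ℝ) | F z - F x < r.1 ∧ ∀ j, G j z < r.2 j} := by
      ext r
      simp only [hU, Set.mem_iUnion, exists_prop]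
      rfl
    rw [this]
    refine isOpen_biUnion fun z _ => ?_
    have h := (isOpen_lt (continuous_const (y := F z - F x)) continuous_fst).inter
      (isOpen_iInter_of_finite fun j : Fin m => isOpen_lt (continuous_const (y := G j z))
        ((continuous_apply j).comp (continuous_snd (X := ℝ) (Y := Fin m → ℝ))))
    convert h using 1
    ext r
    simp
  have hUc : Convex ℝ U := by
    rintro ⟨r, r'⟩ ⟨z, hz, h1, h2⟩ ⟨s, s'⟩ ⟨w, hw, h3, h4⟩ a b ha hb hab
    refine ⟨a • z + b • w, hF.1 hz hw ha hb hab, ?_, fun j => ?_⟩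
    · have h := hF.2 hz hw ha hb hab
      simp only [smul_eq_mul, Prod.fst_add, Prod.smul_fst] at h h1 h3 ⊢
      have hb' : b = 1 - a := by linarith
      subst hb'
      rcases ha.eq_or_lt with rfl | ha
      · simp at h ⊢; linarith
      · nlinarith [mul_lt_mul_of_pos_left h1 ha, mul_le_mul_of_nonneg_left h3.le hb]
    · have h := (hG j).2 hz hw ha hb hab
      have h1 := h2 j
      have h3 := h4 j
      simp only [smul_eq_mul, Prod.snd_add, Prod.smul_snd, Pi.add_apply, Pi.smul_apply] at h h1 h3 ⊢
      have hb' : b = 1 - a := by linarith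
      subst hb'
      rcases ha.eq_or_lt with rfl | ha
      · simp at h ⊢; linarith
      · nlinarith [mul_lt_mul_of_pos_left h1 ha, mul_le_mul_of_nonneg_left h3.le hb]
  have h0 : (0 : ℝ × (Fin m → ℝ)) ∉ U := by
    rintro ⟨z, hz, h1, h2⟩
    have := hmin z hz fun j => (h2 j).le
    simp only [Prod.fst_zero] at h1
    linarith
  obtain ⟨f, hf⟩ := geometric_hahn_banach_open_point hUc hUo h0
  rw [map_zero] at hf
  set a : ℝ := -f (1, 0) with ha
  set b : Fin m → ℝ := fun j => -f (0, Pi.single j 1) with hb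
  have hfe : ∀ r s, f (r, s) = -(a * r + ∑ j, b j * s j) := by
    intro r s
    have h1 : ((r, s) : ℝ × (Fin m → ℝ)) = r • (1, 0) + ∑ j, s j • (0, Pi.single j 1) := by
      ext j
      · simp [Prod.fst_sum]
      · simp [Prod.snd_sum, Finset.sum_apply, Pi.single_apply]
    rw [h1, map_add, map_smul, map_sum]
    simp only [map_smul, smul_eq_mul, ha, hb, neg_mul, Finset.sum_neg_distrib]
    rw [neg_add, neg_neg, neg_neg, mul_comm]
    congr 1
    exact Finset.sum_congr rfl fun j _ => mul_comm _ _
  have hpos : ∀ z ∈ D, ∀ (r : ℝ) (s : Fin m → ℝ), F z - F x < r → (∀ j, G j z < s j) → 0 < a * r + ∑ j, b j * s j := by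
    intro z hz r s h1 h2
    have := hf (r, s) ⟨z, hz, h1, h2⟩
    rw [hfe] at this
    linarith
  have hge : ∀ z ∈ D, ∀ (r : ℝ) (s : Fin m → ℝ), F z - F x ≤ r → (∀ j, G j z ≤ s j) →
      0 ≤ a * r + ∑ j, b j * s j := by
    intro z hz r s h1 h2
    have hlim : Filter.Tendsto (fun e : ℝ => a * (r + e) + ∑ j, b j * (s j + e))
        (nhdsWithin 0 (Set.Ioi 0)) (nhds (a * (r + 0) + ∑ j, b j * (s j + 0))) := by
      refine Filter.Tendsto.mono_left ?_ nhdsWithin_le_nhds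
      exact Continuous.tendsto (by fun_prop) 0
    simp only [add_zero] at hlim
    refine ge_of_tendsto hlim ?_
    filter_upwards [self_mem_nhdsWithin] with e he
    exact (hpos z hz _ _ (by have : 0 < e := he; linarith)
      (fun j => by have : 0 < e := he; have := h2 j; linarith)).le
  -- `U` is closed under increasing any coordinate, so no coefficient of the functional can be
  -- negative.
  have hrec : ∀ c d : ℝ, (∀ t : ℝ, 0 ≤ t → 0 ≤ c + t * d) → 0 ≤ d := by
    intro c d h
    by_contra hd
    push Not at hd
    have h1 := h ((|c| + 1) / (-d)) (by have := neg_pos.2 hd; positivity)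
    have h2 : (|c| + 1) / (-d) * d = -(|c| + 1) := by rw [div_neg, neg_mul, div_mul_cancel₀ _ hd.ne]
    have := le_abs_self c
    linarith
  have ha0 : 0 ≤ a := by
    refine hrec (∑ j, b j * G j x) a fun t ht => ?_
    have := hge x hx t (fun j => G j x) (by linarith) (fun j => le_rfl)
    linarith [mul_comm a t]
  have hb0 : ∀ j, 0 ≤ b j := by
    intro j
    refine hrec (∑ i, b i * G i x) (b j) fun t ht => ?_
    have := hge x hx 0 (fun i => G i x + t * (Pi.single j 1 : Fin m → ℝ) i) (by linarith) (fun i => by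
      have : 0 ≤ (Pi.single j 1 : Fin m → ℝ) i := by
        rw [Pi.single_apply]; split_ifs <;> norm_num
      nlinarith [mul_nonneg ht this])
    simp only [mul_zero, zero_add, mul_add, Finset.sum_add_distrib, Pi.single_apply, mul_ite, mul_one,
      Finset.sum_ite_eq', Finset.mem_univ, if_true] at this
    linarith [mul_comm t (b j)]
  -- If the objective coefficient vanished, the Slater point would force every `b j` to vanish,
  -- contradicting strict separation.
  have ha1 : 0 < a := by
    refine lt_of_le_of_ne ha0 fun h => ?_
    have h1 := hge z₀ hz₀ (F z₀ - F x) (fun j => G j z₀) le_rfl fun j => le_rfl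
    rw [← h, zero_mul, zero_add] at h1
    have h2 : ∀ j ∈ Finset.univ, b j * G j z₀ ≤ 0 :=
      fun j _ => mul_nonpos_of_nonneg_of_nonpos (hb0 j) (hz₀s j).le
    have h3 := (Finset.sum_eq_zero_iff_of_nonpos h2).1 (le_antisymm (Finset.sum_nonpos h2) h1)
    have h4 : ∀ j, b j = 0 := fun j =>
      (mul_eq_zero.1 (h3 j (Finset.mem_univ j))).resolve_right (hz₀s j).ne
    have h5 := hpos z₀ hz₀ (F z₀ - F x + 1) 0 (by linarith) hz₀s
    rw [← h] at h5
    simp at h5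
  refine ⟨fun j => b j / a, fun j => div_nonneg (hb0 j) ha0, fun j => ?_, fun z hz => ?_⟩
  · have h1 := hge x hx 0 (fun j => G j x) (by linarith) fun j => le_rfl
    rw [mul_zero, zero_add] at h1
    have h2 : ∀ j ∈ Finset.univ, b j * G j x ≤ 0 :=
      fun j _ => mul_nonpos_of_nonneg_of_nonpos (hb0 j) (hfeas j)
    have h3 := (Finset.sum_eq_zero_iff_of_nonpos h2).1 (le_antisymm (Finset.sum_nonpos h2) h1) j
      (Finset.mem_univ j)
    rw [div_mul_eq_mul_div, h3, zero_div]
  · have h1 := hge z hz (F z - F x) (fun j => G j z) le_rfl fun j => le_rfl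
    have h2 : ∑ j, b j / a * G j z = (∑ j, b j * G j z) / a := by
      rw [Finset.sum_div]
      exact Finset.sum_congr rfl fun j _ => by ring
    rw [h2, ← sub_le_iff_le_add', le_div_iff₀ ha1]
    linarith

end ConvexAnalysis

/-! ### First-order inequalities for convex and smooth functions. -/

section SmoothConvex

variable {E : Type*} [NormedAddCommGroup E] [InnerProductSpace ℝ E]

/-- First-order optimality for a convex function plus a quadratic. -/
theorem ConvexOn.le_of_isMinOn_add_sq {S : Set E} {F : E → ℝ} (hF : ConvexOn ℝ S F) {L : ℝ}
    {c x : E} (hx : x ∈ S)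
    (hmin : ∀ z ∈ S, F x + L / 2 * ‖x - c‖ ^ 2 ≤ F z + L / 2 * ‖z - c‖ ^ 2) {z : E} (hz : z ∈ S) :
    F x - L * inner ℝ (x - c) (z - x) ≤ F z := by
  have hseg : ∀ s : ℝ, 0 < s → s ≤ 1 →
      0 ≤ F z - F x + L * inner ℝ (x - c) (z - x) + L / 2 * (s * ‖z - x‖ ^ 2) := by
    intro s hs hs1
    have h1 := hF.2 hx hz (by linarith : (0 : ℝ) ≤ 1 - s) hs.le (by ring)
    have h2 := hmin _ (hF.1 hx hz (by linarith : (0 : ℝ) ≤ 1 - s) hs.le (by ring))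
    have h3 : (1 - s) • x + s • z - c = (x - c) + s • (z - x) := by
      rw [sub_smul, smul_sub, one_smul]; abel
    rw [h3, norm_add_sq_real, inner_smul_right, norm_smul, mul_pow, Real.norm_eq_abs, sq_abs] at h2
    simp only [smul_eq_mul] at h1
    have h4 : 0 ≤ s * (F z - F x + L * inner ℝ (x - c) (z - x) + L / 2 * (s * ‖z - x‖ ^ 2)) := by
      linarith
    exact nonneg_of_mul_nonneg_right h4 hs
  have hlim : Filter.Tendsto
      (fun s : ℝ => F z - F x + L * inner ℝ (x - c) (z - x) + L / 2 * (s * ‖z - x‖ ^ 2))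
      (nhdsWithin 0 (Set.Ioi 0))
      (nhds (F z - F x + L * inner ℝ (x - c) (z - x) + L / 2 * (0 * ‖z - x‖ ^ 2))) :=
    (Continuous.tendsto (by fun_prop) 0).mono_left nhdsWithin_le_nhds
  have := ge_of_tendsto hlim (b := 0) (by
    filter_upwards [Ioc_mem_nhdsGT (zero_lt_one' ℝ)] with s hs using hseg s hs.1 hs.2)
  simp only [zero_mul, mul_zero, add_zero] at this
  linarith

/-- Quadratic growth of a strongly convex function at its minimizer. -/
theorem ConvexOn.add_sq_le_of_isMinOn_add_sq {S : Set E} {F : E → ℝ} (hF : ConvexOn ℝ S F) {L : ℝ}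
    {c x : E} (hx : x ∈ S)
    (hmin : ∀ z ∈ S, F x + L / 2 * ‖x - c‖ ^ 2 ≤ F z + L / 2 * ‖z - c‖ ^ 2) {z : E} (hz : z ∈ S) :
    F x + L / 2 * ‖x - c‖ ^ 2 + L / 2 * ‖z - x‖ ^ 2 ≤ F z + L / 2 * ‖z - c‖ ^ 2 := by
  have h1 := hF.le_of_isMinOn_add_sq hx hmin hz
  have h2 : z - c = (x - c) + (z - x) := by abel
  rw [h2, norm_add_sq_real]
  linarith

/-- Lets the gradient of a supremum be read off from two-sided quadratic bounds. -/
theorem hasGradientAt_of_abs_sub_le_sq [CompleteSpace E] {f : E → ℝ} {v x : E} {C : ℝ}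
    (h : ∀ z, |f z - f x - inner ℝ v (z - x)| ≤ C * ‖z - x‖ ^ 2) : HasGradientAt f v x := by
  rw [hasGradientAt_iff_isLittleO]
  have h1 : (fun z => f z - f x - inner ℝ v (z - x)) =O[nhds x] fun z => ‖z - x‖ ^ 2 :=
    Asymptotics.IsBigO.of_bound C (Filter.Eventually.of_forall fun z => by
      simpa using h z)
  refine h1.trans_isLittleO ?_
  have h2 : (fun z : E => ‖z - x‖ ^ 2) =o[nhds x] fun z => ‖z - x‖ := by
    simp only [pow_two]
    have h3 : Filter.Tendsto (fun z : E => ‖z - x‖) (nhds x) (nhds 0) := by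
      have : Continuous fun z : E => ‖z - x‖ := by fun_prop
      simpa using this.tendsto x
    simpa using ((Asymptotics.isLittleO_one_iff ℝ).2 h3).mul_isBigO
      (Asymptotics.isBigO_refl (fun z : E => ‖z - x‖) (nhds x))
  exact h2.of_norm_right

theorem ConvexOn.add_inner_gradient_le [CompleteSpace E] {f : E → ℝ}
    (hf : ConvexOn ℝ Set.univ f) {x : E} (hd : DifferentiableAt ℝ f x) (z : E) :
    f x + inner ℝ (gradient f x) (z - x) ≤ f z := by
  have hl : HasDerivAt (fun t : ℝ => x + t • (z - x)) (z - x) 0 := by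
    simpa using ((hasDerivAt_id (0 : ℝ)).smul_const (z - x)).const_add x
  have hd' : HasFDerivAt f (fderiv ℝ f x) (x + (0 : ℝ) • (z - x)) := by
    simpa using hd.hasFDerivAt
  have h1 := hd'.comp_hasDerivAt (0 : ℝ) hl
  have h2 : ConvexOn ℝ Set.univ (f ∘ fun t : ℝ => x + t • (z - x)) := by
    refine ⟨convex_univ, fun s _ t _ a b ha hb hab => ?_⟩
    have h := hf.2 (Set.mem_univ (x + s • (z - x))) (Set.mem_univ (x + t • (z - x))) ha hb hab
    refine le_trans (le_of_eq ?_) h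
    simp only [Function.comp]
    congr 1
    have : x = a • x + b • x := by rw [← add_smul, hab, one_smul]
    nth_rewrite 1 [this]
    simp only [smul_add, smul_smul, add_smul, smul_eq_mul]
    abel
  have h3 := h2.le_slope_of_hasDerivAt (Set.mem_univ 0) (Set.mem_univ 1) zero_lt_one h1
  rw [slope_def_field] at h3
  simp only [Function.comp, one_smul, zero_smul, add_zero, sub_zero, div_one,
    add_sub_cancel] at h3
  have h4 : inner ℝ (gradient f x) (z - x) = fderiv ℝ f x (z - x) := by
    rw [← toDual_gradient, InnerProductSpace.toDual_apply_apply]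
  linarith

end SmoothConvex

/-! ### Nesterov smoothing and the two-sided surrogate bounds. -/

namespace DCProblem

variable {d m : ℕ} (P : DCProblem d m)

theorem bddAbove_g (i : Fin (m + 1)) (x : Vec d) :
    BddAbove ((fun y => inner ℝ (P.A i x) y - P.p i y) '' P.Y i) :=
  (P.Y_compact i).bddAbove_image
    ((Continuous.continuousOn (by fun_prop)).sub (P.p_continuous i))

theorem continuousOn_gSmooth_objective (β : Fin (m + 1) → ℝ) (i : Fin (m + 1)) (x : Vec d) :
    ContinuousOn (fun y => inner ℝ (P.A i x) y - P.p i y - β i / 2 * ‖y - P.yhat i‖ ^ 2) (P.Y i) :=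
  ((Continuous.continuousOn (by fun_prop)).sub (P.p_continuous i)).sub
    (Continuous.continuousOn (by fun_prop))

theorem norm_sub_yhat_le_D (i : Fin (m + 1)) {y : Vec (P.a i)} (hy : y ∈ P.Y i) :
    ‖y - P.yhat i‖ ≤ P.D i :=
  le_csSup ((P.Y_compact i).bddAbove_image (Continuous.continuousOn (by fun_prop)))
    (Set.mem_image_of_mem _ hy)

variable {P} {β : Fin (m + 1) → ℝ}

theorem gSmooth_le_g (hβ : ∀ i, 0 < β i) (i : Fin (m + 1)) (x : Vec d) :
    P.gSmooth β i x ≤ P.g i x := by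
  refine csSup_le ((P.Y_nonempty i).image _) ?_
  rintro _ ⟨y, hy, rfl⟩
  have h1 := le_csSup (P.bddAbove_g i x) (Set.mem_image_of_mem _ hy)
  have h2 : 0 ≤ β i / 2 * ‖y - P.yhat i‖ ^ 2 := mul_nonneg (half_pos (hβ i)).le (sq_nonneg _)
  simp only at h1 ⊢
  unfold g
  linarith

theorem g_le_gSmooth_add (hβ : ∀ i, 0 < β i) {ν : ℝ} (hν : ∀ i, ν = β i * P.D i ^ 2 / 2)
    (i : Fin (m + 1)) (x : Vec d) : P.g i x ≤ P.gSmooth β i x + ν := by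
  refine csSup_le ((P.Y_nonempty i).image _) ?_
  rintro _ ⟨y, hy, rfl⟩
  have h1 := le_csSup ((P.Y_compact i).bddAbove_image (P.continuousOn_gSmooth_objective β i x))
    (Set.mem_image_of_mem _ hy)
  have h2 : ‖y - P.yhat i‖ ^ 2 ≤ P.D i ^ 2 :=
    pow_le_pow_left₀ (norm_nonneg _) (P.norm_sub_yhat_le_D i hy) 2
  have h3 := mul_le_mul_of_nonneg_left h2 (half_pos (hβ i)).le
  simp only at h1 ⊢
  unfold gSmooth
  have := hν i
  linarith

theorem psiSmooth_le_psi (hβ : ∀ i, 0 < β i) (i : Fin (m + 1)) (x : Vec d) :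
    P.psiSmooth β i x ≤ P.psi i x := by
  have := gSmooth_le_g (P := P) hβ i x
  unfold psiSmooth fSmooth psi
  linarith

theorem psi_le_psiSmooth_add (hβ : ∀ i, 0 < β i) {ν : ℝ} (hν : ∀ i, ν = β i * P.D i ^ 2 / 2)
    (i : Fin (m + 1)) (x : Vec d) : P.psi i x ≤ P.psiSmooth β i x + ν := by
  have := g_le_gSmooth_add (P := P) hβ hν i x
  unfold psiSmooth fSmooth psi
  linarith

/-- The strongly concave maximization defining the smoothed function has a maximizer with quadratic
decay. -/
theorem exists_argmax_gSmooth (i : Fin (m + 1)) (x : Vec d) :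
    ∃ y ∈ P.Y i,
      P.gSmooth β i x = inner ℝ (P.A i x) y - P.p i y - β i / 2 * ‖y - P.yhat i‖ ^ 2 ∧
      ∀ z ∈ P.Y i, inner ℝ (P.A i x) z - P.p i z - β i / 2 * ‖z - P.yhat i‖ ^ 2
        + β i / 2 * ‖z - y‖ ^ 2 ≤ P.gSmooth β i x := by
  obtain ⟨y, hy, hmax⟩ := (P.Y_compact i).exists_isMaxOn (P.Y_nonempty i)
    (P.continuousOn_gSmooth_objective β i x)
  have heq : P.gSmooth β i x
      = inner ℝ (P.A i x) y - P.p i y - β i / 2 * ‖y - P.yhat i‖ ^ 2 := by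
    refine IsGreatest.csSup_eq ⟨Set.mem_image_of_mem _ hy, ?_⟩
    rintro _ ⟨z, hz, rfl⟩
    exact isMaxOn_iff.1 hmax z hz
  refine ⟨y, hy, heq, fun z hz => ?_⟩
  have hconv : ConvexOn ℝ (P.Y i) (fun y => P.p i y + inner ℝ (-(P.A i x)) y) :=
    (P.p_convex i).add ((innerₛₗ ℝ (-(P.A i x))).convexOn (P.Y_convex i))
  have h := hconv.add_sq_le_of_isMinOn_add_sq (L := β i) (c := P.yhat i) hy (fun w hw => by
    have := isMaxOn_iff.1 hmax w hw
    simp only [inner_neg_left] at this ⊢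
    linarith) hz
  rw [heq]
  simp only [inner_neg_left] at h
  linarith

/-- Danskin: the smoothed function is convex with an `‖Aᵢ‖² / βᵢ`-Lipschitz gradient. -/
theorem gSmooth_expansion (hβ : ∀ i, 0 < β i) (i : Fin (m + 1)) :
    (∀ x, HasGradientAt (P.gSmooth β i) (gradient (P.gSmooth β i) x) x) ∧
    (∀ x z, P.gSmooth β i x + inner ℝ (gradient (P.gSmooth β i) x) (z - x) ≤ P.gSmooth β i z) ∧
    (∀ x z, P.gSmooth β i z ≤ P.gSmooth β i x + inner ℝ (gradient (P.gSmooth β i) x) (z - x)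
      + ‖P.A i‖ ^ 2 / β i / 2 * ‖z - x‖ ^ 2) ∧
    ∀ x z, ‖gradient (P.gSmooth β i) x - gradient (P.gSmooth β i) z‖
      ≤ ‖P.A i‖ ^ 2 / β i * ‖x - z‖ := by
  -- The gradient will be the adjoint of `A i` applied to the maximizer `y x`: testing `y x` at `z`
  -- gives the lower bound, and quadratic decay from `y x` plus Young's inequality the upper one.
  choose y hy heq hle using fun x => exists_argmax_gSmooth (P := P) (β := β) i x
  have hb := hβ i
  have hA : ∀ w u, inner ℝ (P.A i w) u ≤ ‖P.A i‖ * ‖w‖ * ‖u‖ := fun w u =>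
    (real_inner_le_norm _ _).trans
      (mul_le_mul_of_nonneg_right ((P.A i).le_opNorm w) (norm_nonneg _))
  have hadj : ∀ w u, inner ℝ ((P.A i).adjoint u) w = inner ℝ (P.A i w) u := fun w u => by
    rw [ContinuousLinearMap.adjoint_inner_left, real_inner_comm]
  have hlow : ∀ x z, P.gSmooth β i x + inner ℝ ((P.A i).adjoint (y x)) (z - x)
      ≤ P.gSmooth β i z := by
    intro x z
    have h1 := hle z (y x) (hy x)
    have h2 : 0 ≤ β i / 2 * ‖y x - y z‖ ^ 2 := mul_nonneg (half_pos hb).le (sq_nonneg _)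
    rw [heq x, hadj, map_sub, inner_sub_left]
    linarith
  have hup : ∀ x z, P.gSmooth β i z ≤ P.gSmooth β i x
      + inner ℝ ((P.A i).adjoint (y x)) (z - x) + ‖P.A i‖ ^ 2 / β i / 2 * ‖z - x‖ ^ 2 := by
    intro x z
    have h1 := hle x (y z) (hy z)
    have h2 : inner ℝ (P.A i (z - x)) (y z) = inner ℝ (P.A i (z - x)) (y x)
        + inner ℝ (P.A i (z - x)) (y z - y x) := by rw [inner_sub_right]; ring
    have h3 := hA (z - x) (y z - y x)
    have h4 : ‖P.A i‖ * ‖z - x‖ * ‖y z - y x‖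
        ≤ ‖P.A i‖ ^ 2 / β i / 2 * ‖z - x‖ ^ 2 + β i / 2 * ‖y z - y x‖ ^ 2 := by
      have h5 : ‖P.A i‖ ^ 2 / β i / 2 * ‖z - x‖ ^ 2 + β i / 2 * ‖y z - y x‖ ^ 2
          - ‖P.A i‖ * ‖z - x‖ * ‖y z - y x‖
          = (‖P.A i‖ * ‖z - x‖ - β i * ‖y z - y x‖) ^ 2 / (2 * β i) := by
        field_simp; ring
      have h6 : 0 ≤ (‖P.A i‖ * ‖z - x‖ - β i * ‖y z - y x‖) ^ 2 / (2 * β i) := by positivity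
      linarith
    rw [heq z, hadj]
    have h7 : inner ℝ (P.A i z) (y z)
        = inner ℝ (P.A i x) (y z) + inner ℝ (P.A i (z - x)) (y z) := by
      rw [map_sub, inner_sub_left]; ring
    linarith
  have hgrad : ∀ x, HasGradientAt (P.gSmooth β i) ((P.A i).adjoint (y x)) x := fun x =>
    hasGradientAt_of_abs_sub_le_sq (C := ‖P.A i‖ ^ 2 / β i / 2) fun z => by
      rw [abs_le]
      have h1 := hlow x z
      have h2 := hup x z
      have h3 : 0 ≤ ‖P.A i‖ ^ 2 / β i / 2 * ‖z - x‖ ^ 2 := by positivity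
      constructor <;> linarith
  have hG : gradient (P.gSmooth β i) = fun x => (P.A i).adjoint (y x) := gradient_eq hgrad
  rw [hG]
  refine ⟨hgrad, hlow, hup, fun x z => ?_⟩
  have h1 := hle x (y z) (hy z)
  have h2 := hle z (y x) (hy x)
  have h3 := hA (x - z) (y x - y z)
  -- Sum of the two decay inequalities, each maximizer tested in the other's problem; it makes `y`
  -- Lipschitz with constant `‖A i‖ / β i`.
  have h4 : β i * ‖y x - y z‖ ^ 2 ≤ inner ℝ (P.A i (x - z)) (y x - y z) := by
    rw [map_sub, inner_sub_left, inner_sub_right, inner_sub_right]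
    rw [norm_sub_rev (y z) (y x)] at h1
    have := heq x
    have := heq z
    linarith
  have h5 : ‖y x - y z‖ ≤ ‖P.A i‖ / β i * ‖x - z‖ := by
    rcases (norm_nonneg (y x - y z)).eq_or_lt with h0 | h0
    · rw [← h0]; positivity
    · rw [div_mul_eq_mul_div, le_div_iff₀ hb]
      refine le_of_mul_le_mul_right ?_ h0
      linarith
  rw [← map_sub]
  calc ‖(P.A i).adjoint (y x - y z)‖ ≤ ‖(P.A i).adjoint‖ * ‖y x - y z‖ :=
        ContinuousLinearMap.le_opNorm _ _
    _ = ‖P.A i‖ * ‖y x - y z‖ := by rw [LinearIsometryEquiv.norm_map]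
    _ ≤ ‖P.A i‖ * (‖P.A i‖ / β i * ‖x - z‖) := mul_le_mul_of_nonneg_left h5 (norm_nonneg _)
    _ = ‖P.A i‖ ^ 2 / β i * ‖x - z‖ := by ring

/-- The upper bound combines the gradient inequality at `z` with Cauchy–Schwarz. This avoids
integration, at the price of `Lh` in place of `Lh / 2`. -/
theorem h_expansion (i : Fin (m + 1)) (x z : Vec d) :
    P.h i x + inner ℝ (gradient (P.h i) x) (z - x) ≤ P.h i z ∧
      P.h i z ≤ P.h i x + inner ℝ (gradient (P.h i) x) (z - x) + P.Lh i * ‖z - x‖ ^ 2 := by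
  refine ⟨(P.h_convex i).add_inner_gradient_le (P.h_differentiable i x) z, ?_⟩
  have h1 := (P.h_convex i).add_inner_gradient_le (P.h_differentiable i z) x
  have h2 := real_inner_le_norm (gradient (P.h i) z - gradient (P.h i) x) (z - x)
  have h3 := mul_le_mul_of_nonneg_right (P.h_smooth i z x) (norm_nonneg (z - x))
  rw [← neg_sub z x, inner_neg_right] at h1
  rw [inner_sub_left] at h2
  nlinarith

theorem gradient_fSmooth (hβ : ∀ i, 0 < β i) (i : Fin (m + 1)) (x : Vec d) :
    gradient (P.fSmooth β i) x = gradient (P.gSmooth β i) x - gradient (P.h i) x := by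
  refine HasGradientAt.gradient ?_
  have h1 := ((gSmooth_expansion (P := P) hβ i).1 x).hasFDerivAt
  have h2 := (P.h_differentiable i x).hasGradientAt.hasFDerivAt
  rw [hasGradientAt_iff_hasFDerivAt, map_sub]
  exact h1.sub h2

theorem norm_sq_div_le_Lip (i : Fin (m + 1)) : ‖P.A i‖ ^ 2 / β i ≤ P.Lip β i := le_max_left _ _

theorem Lh_le_Lip (i : Fin (m + 1)) : P.Lh i ≤ P.Lip β i := le_max_right _ _

theorem Lip_nonneg (i : Fin (m + 1)) : 0 ≤ P.Lip β i := (P.Lh_nonneg i).trans (Lh_le_Lip i)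

/-- Linearizing the concave `-h` only overestimates, so the quadratic term has to absorb the
curvature of `gSmooth` alone. -/
theorem psiSmooth_le_surrogate (hβ : ∀ i, 0 < β i) (i : Fin (m + 1)) (x z : Vec d) :
    P.psiSmooth β i z ≤ P.surrogate β x i z := by
  have h1 := (gSmooth_expansion (P := P) hβ i).2.2.1 x z
  have h2 := (h_expansion (P := P) i x z).1
  have h3 := mul_le_mul_of_nonneg_right (norm_sq_div_le_Lip (P := P) (β := β) i)
    (sq_nonneg ‖z - x‖)
  unfold psiSmooth surrogate oracle
  simp only [gradient_fSmooth hβ, inner_sub_left]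
  unfold fSmooth
  linarith

/-- The `3 / 2` is `1 / 2` from the quadratic term plus `1` from the upper bound in `h_expansion`.
-/
theorem surrogate_le_psiSmooth_add (hβ : ∀ i, 0 < β i) (i : Fin (m + 1)) (x z : Vec d) :
    P.surrogate β x i z ≤ P.psiSmooth β i z + 3 / 2 * P.Lip β i * ‖z - x‖ ^ 2 := by
  have h1 := (gSmooth_expansion (P := P) hβ i).2.1 x z
  have h2 := (h_expansion (P := P) i x z).2
  have h3 := mul_le_mul_of_nonneg_right (Lh_le_Lip (P := P) (β := β) i) (sq_nonneg ‖z - x‖)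
  unfold psiSmooth surrogate oracle
  simp only [gradient_fSmooth hβ, inner_sub_left]
  unfold fSmooth
  linarith

theorem surrogate_self (β : Fin (m + 1) → ℝ) (i : Fin (m + 1)) (x : Vec d) :
    P.surrogate β x i x = P.psiSmooth β i x := by
  simp [surrogate, oracle, psiSmooth]

theorem norm_gradient_fSmooth_sub_le (hβ : ∀ i, 0 < β i) (i : Fin (m + 1)) (x z : Vec d) :
    ‖gradient (P.fSmooth β i) x - gradient (P.fSmooth β i) z‖ ≤ 2 * P.Lip β i * ‖x - z‖ := by
  have h1 := (gSmooth_expansion (P := P) hβ i).2.2.2 x z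
  have h2 := P.h_smooth i x z
  have h3 := mul_le_mul_of_nonneg_right (norm_sq_div_le_Lip (P := P) (β := β) i)
    (norm_nonneg (x - z))
  have h4 := mul_le_mul_of_nonneg_right (Lh_le_Lip (P := P) (β := β) i) (norm_nonneg (x - z))
  have h5 : gradient (P.fSmooth β i) x - gradient (P.fSmooth β i) z
      = (gradient (P.gSmooth β i) x - gradient (P.gSmooth β i) z)
        - (gradient (P.h i) x - gradient (P.h i) z) := by
    rw [gradient_fSmooth hβ, gradient_fSmooth hβ]; abel
  have h6 := norm_sub_le (gradient (P.gSmooth β i) x - gradient (P.gSmooth β i) z)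
    (gradient (P.h i) x - gradient (P.h i) z)
  rw [h5]
  linarith

/-- The gradient of the smoothed function is a `ν`-subgradient of the max-type function. -/
theorem gradient_gSmooth_mem_epsSubdiff (hβ : ∀ i, 0 < β i) {ν : ℝ}
    (hν : ∀ i, ν = β i * P.D i ^ 2 / 2) (i : Fin (m + 1)) (x : Vec d) :
    gradient (P.gSmooth β i) x ∈ epsSubdiff Set.univ ν (P.g i) x := by
  refine ⟨Set.mem_univ _, fun z _ => ?_⟩
  have h1 := (gSmooth_expansion (P := P) hβ i).2.1 x z
  have h2 := gSmooth_le_g (P := P) hβ i z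
  have h3 := g_le_gSmooth_add (P := P) hβ hν i x
  linarith

end DCProblem

/-! ### Weighted subdifferential sums and the multipliers of a subproblem. -/

theorem mem_weightedSum_iff {d m : ℕ} {S : Fin (m + 1) → Set (Vec d)} {lam : Fin m → ℝ}
    {v : Vec d} : v ∈ weightedSum S lam ↔ ∃ e : Fin (m + 1) → Vec d, e 0 ∈ S 0 ∧
      (∀ j, lam j ≠ 0 → e j.succ ∈ S j.succ) ∧ e 0 + ∑ j, lam j • e j.succ = v := by
  unfold weightedSum
  rw [Set.mem_add]
  constructor
  · rintro ⟨e₀, he₀, w, hw, rfl⟩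
    rw [Set.mem_fintype_sum] at hw
    obtain ⟨u, hu, rfl⟩ := hw
    have : ∀ j, ∃ e : Vec d, (lam j ≠ 0 → e ∈ S j.succ) ∧ lam j • e = u j := by
      intro j
      have h := hu j
      split_ifs at h with h0
      · exact ⟨0, fun h1 => absurd h0 h1, by rw [Set.mem_singleton_iff.1 h, smul_zero]⟩
      · obtain ⟨e, he, heq⟩ := Set.mem_smul_set.1 h
        exact ⟨e, fun _ => he, heq⟩
    choose e he heq using this
    refine ⟨Fin.cons e₀ e, by simpa using he₀, fun j hj => by simpa using he j hj, ?_⟩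
    simp [heq]
  · rintro ⟨e, h0, hs, rfl⟩
    refine ⟨e 0, h0, _, ?_, rfl⟩
    rw [Set.mem_fintype_sum]
    refine ⟨fun j => lam j • e j.succ, fun j => ?_, rfl⟩
    split_ifs with h
    · simp [h]
    · exact Set.smul_mem_smul_set (hs j h)

/-- Carries stationarity from the surrogates to the original functions: the total shift bounds the
distance to zero. -/
theorem add_mem_weightedSum {d m : ℕ} {S T : Fin (m + 1) → Set (Vec d)} {lam : Fin m → ℝ}
    {v : Vec d} (hv : v ∈ weightedSum S lam) (r : Fin (m + 1) → Vec d)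
    (h : ∀ i, ∀ e ∈ S i, e + r i ∈ T i) :
    v + (r 0 + ∑ j, lam j • r j.succ) ∈ weightedSum T lam := by
  obtain ⟨e, h0, hs, rfl⟩ := mem_weightedSum_iff.1 hv
  refine mem_weightedSum_iff.2
    ⟨fun i => e i + r i, h 0 _ h0, fun j hj => h _ _ (hs j hj), ?_⟩
  simp only [smul_add, Finset.sum_add_distrib]
  abel

namespace DCProblem

variable {d m : ℕ} {P : DCProblem d m} {β : Fin (m + 1) → ℝ}

theorem convexOn_chiReal (i : Fin (m + 1)) : ConvexOn ℝ P.dom (P.chiReal i) := by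
  refine Fin.cases ?_ (fun j => ?_) i
  · exact P.chi0_convex
  · exact P.chi_convex j

/-- The surrogate without its quadratic term. -/
noncomputable def linearized (P : DCProblem d m) (β : Fin (m + 1) → ℝ) (xk : Vec d)
    (i : Fin (m + 1)) (z : Vec d) : ℝ :=
  P.chiReal i z + (inner ℝ (P.oracle β i xk).2 z
    + ((P.oracle β i xk).1 - inner ℝ (P.oracle β i xk).2 xk))

theorem surrogate_eq (xk : Vec d) (i : Fin (m + 1)) (z : Vec d) :
    P.surrogate β xk i z = P.linearized β xk i z + P.Lip β i / 2 * ‖z - xk‖ ^ 2 := by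
  unfold surrogate linearized
  rw [inner_sub_right]
  ring

theorem convexOn_linearized (xk : Vec d) (i : Fin (m + 1)) :
    ConvexOn ℝ P.dom (P.linearized β xk i) :=
  (convexOn_chiReal i).add
    (((innerₛₗ ℝ (P.oracle β i xk).2).convexOn (convexOn_chiReal (P := P) i).1).add_const _)

theorem convexOn_surrogate (xk : Vec d) (i : Fin (m + 1)) :
    ConvexOn ℝ P.dom (P.surrogate β xk i) := by
  have h1 : ConvexOn ℝ P.dom (fun z : Vec d => ‖z - xk‖ ^ 2) := by
    have h2 : ConvexOn ℝ Set.univ (fun z : Vec d => ‖z - xk‖) := by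
      have := (convexOn_univ_norm (E := Vec d)).translate_left (-xk)
      simpa [Function.comp_def, sub_eq_add_neg, Set.preimage_univ] using this
    exact ((h2.pow (fun _ _ => norm_nonneg _) 2).subset (Set.subset_univ _)
      (convexOn_chiReal (P := P) i).1)
  have h3 := (convexOn_linearized (P := P) (β := β) xk i).add
    (h1.smul (div_nonneg (Lip_nonneg (P := P) (β := β) i) two_pos.le))
  have h4 : P.surrogate β xk i
      = P.linearized β xk i + fun z => (P.Lip β i / 2) • ‖z - xk‖ ^ 2 := by
    funext z
    simp [surrogate_eq]
  rw [h4]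
  exact h3

/-- Karush–Kuhn–Tucker multipliers of a subproblem that satisfies Slater's condition. -/
theorem exists_isMultiplier {lev : Fin m → ℝ} {xk x : Vec d}
    (hx : P.IsSubproblemSolution β lev xk x)
    (hslater : ∃ z ∈ P.dom, ∀ j : Fin m, P.surrogate β xk j.succ z < lev j) :
    ∃ lam : Fin m → ℝ, P.IsMultiplier β lev xk x lam := by
  obtain ⟨⟨hxd, hfeas⟩, hmin⟩ := hx
  have hD : Convex ℝ P.dom := (convexOn_chiReal (P := P) 0).1
  obtain ⟨lam, hlam, hcomp, hlag⟩ := ConvexOn.exists_lagrange_multipliers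
    (G := fun j z => P.surrogate β xk j.succ z - lev j)
    (convexOn_surrogate (P := P) (β := β) xk 0)
    (fun j => by
      simp only [sub_eq_add_neg]
      exact (convexOn_surrogate (P := P) (β := β) xk j.succ).add_const (-(lev j))) hxd
    (fun j => sub_nonpos.2 (hfeas j)) (fun z hz h => hmin z hz fun j => sub_nonpos.1 (h j))
    (hslater.imp fun z hz => ⟨hz.1, fun j => sub_neg.2 (hz.2 j)⟩)
  refine ⟨lam, hlam, ?_, hcomp⟩
  -- The objective gets weight `1`. Restricting to the support `s` of `w` permits division by `w i`
  -- and matches the omitted terms in `weightedSum`.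
  set w : Fin (m + 1) → ℝ := Fin.cons 1 lam with hw
  have hw0 : ∀ i, 0 ≤ w i := fun i => Fin.cases (by simp [hw]) (fun j => by simpa [hw] using hlam j) i
  set s : Finset (Fin (m + 1)) := Finset.univ.filter fun i => w i ≠ 0 with hs
  have hsum : ∀ f : Fin (m + 1) → ℝ, ∑ i ∈ s, w i * f i = f 0 + ∑ j, lam j * f j.succ := by
    intro f
    rw [hs, Finset.sum_filter_of_ne (fun i _ h => left_ne_zero_of_mul h), Fin.sum_univ_succ]
    simp [hw]
  set M : ℝ := ∑ i ∈ s, w i * P.Lip β i with hM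
  have hconv : ∀ i ∈ s, ConvexOn ℝ P.dom (fun z => w i * P.linearized β xk i z) :=
    fun i _ => (convexOn_linearized (P := P) (β := β) xk i).smul (hw0 i)
  have hconvsum : ConvexOn ℝ P.dom (fun z => ∑ i ∈ s, w i * P.linearized β xk i z) :=
    ConvexOn.finset_sum hD hconv
  have hlagr : ∀ z, ∑ i ∈ s, w i * P.linearized β xk i z + M / 2 * ‖z - xk‖ ^ 2
      = P.surrogate β xk 0 z + ∑ j, lam j * P.surrogate β xk j.succ z := by
    intro z
    rw [← hsum fun i => P.surrogate β xk i z, hM, Finset.sum_div, Finset.sum_mul,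
      ← Finset.sum_add_distrib]
    refine Finset.sum_congr rfl fun i _ => ?_
    rw [surrogate_eq]
    ring
  have hminsum : ∀ z ∈ P.dom, ∑ i ∈ s, w i * P.linearized β xk i x + M / 2 * ‖x - xk‖ ^ 2
      ≤ ∑ i ∈ s, w i * P.linearized β xk i z + M / 2 * ‖z - xk‖ ^ 2 := by
    intro z hz
    rw [hlagr, hlagr]
    have h1 := hlag z hz
    have h2 : ∑ j, lam j * P.surrogate β xk j.succ x = ∑ j, lam j * lev j :=
      Finset.sum_congr rfl fun j _ => by linarith [hcomp j]
    simp only [mul_sub, Finset.sum_sub_distrib] at h1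
    linarith
  have hne : s.Nonempty := ⟨0, by simp [hs, hw]⟩
  -- The Lagrangian is a convex sum plus one quadratic of modulus `M`. Its optimality condition
  -- makes `-(M • (x - xk))` a subgradient of the sum, which is then split among the terms.
  obtain ⟨u, hu1, hu2⟩ := ConvexOn.exists_inner_of_sum s hD hconv hxd (v := -(M • (x - xk))) hne
    (fun z hz => by
      have := hconvsum.le_of_isMinOn_add_sq hxd hminsum hz
      rw [inner_neg_left, real_inner_smul_left]
      linarith)
  have hmem : ∀ i ∈ s, (w i)⁻¹ • u i + P.Lip β i • (x - xk) ∈ P.surrogateSubdiff β xk x i := by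
    intro i hi
    have hwi : w i ≠ 0 := (Finset.mem_filter.1 hi).2
    have hwp : 0 < w i := lt_of_le_of_ne (hw0 i) hwi.symm
    refine Set.mem_add.2 ⟨_, rfl, (w i)⁻¹ • u i - (P.oracle β i xk).2, ⟨hxd, fun z hz => ?_⟩, ?_⟩
    · have h1 := hu2 i hi z hz
      have h2 : inner ℝ (u i) (z - x) = w i * inner ℝ ((w i)⁻¹ • u i) (z - x) := by
        rw [real_inner_smul_left, mul_inv_cancel_left₀ hwi]
      rw [h2, ← mul_add] at h1
      have h3 := le_of_mul_le_mul_left h1 hwp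
      unfold linearized at h3
      rw [inner_sub_left, inner_sub_right (P.oracle β i xk).2]
      linarith
    · abel
  refine mem_weightedSum_iff.2 ⟨fun i => (w i)⁻¹ • u i + P.Lip β i • (x - xk),
    hmem 0 (by simp [hs, hw]), fun j hj => hmem _ (by simpa [hs, hw] using hj), ?_⟩
  have h1 : ∑ i ∈ s, w i • ((w i)⁻¹ • u i + P.Lip β i • (x - xk)) = 0 := by
    have : ∀ i ∈ s, w i • ((w i)⁻¹ • u i + P.Lip β i • (x - xk))
        = u i + (w i * P.Lip β i) • (x - xk) := by
      intro i hi
      rw [smul_add, smul_inv_smul₀ (Finset.mem_filter.1 hi).2, smul_smul]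
    rw [Finset.sum_congr rfl this, Finset.sum_add_distrib, hu1, ← Finset.sum_smul, ← hM]
    abel
  rw [← h1, hs, Finset.sum_filter_of_ne (fun i _ h => left_ne_zero_of_smul h), Fin.sum_univ_succ]
  simp [hw]

/-! ### Levels, feasibility and descent along a run. -/

theorem level_eq (eta0 : Fin m → ℝ) (k : ℕ) (j : Fin m) :
    P.level eta0 k j = P.eta j - (P.eta j - eta0 j) / ((k : ℝ) + 1) := by
  induction k with
  | zero => simp [level]
  | succ k ih =>
    simp only [level, ih]
    push_cast
    field_simp
    ring

variable {eta0 : Fin m → ℝ} {K : ℕ} {x : ℕ → Vec d}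

theorem IsRun.mem_dom (h : P.IsRun β eta0 K x) {k : ℕ} (hk : k ≤ K + 1) : x k ∈ P.dom := by
  cases k with
  | zero => exact h.start_dom
  | succ k => exact (h.step k (by omega)).1.1

theorem IsRun.psiSmooth_le_level (hβ : ∀ i, 0 < β i) (h : P.IsRun β eta0 K x) {k : ℕ}
    (hk : k ≤ K) (j : Fin m) : P.psiSmooth β j.succ (x (k + 1)) ≤ P.level eta0 k j :=
  (psiSmooth_le_surrogate hβ _ _ _).trans ((h.step k hk).1.2 j)

theorem IsRun.level_le_eta (h : P.IsRun β eta0 K x) (k : ℕ) (j : Fin m) :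
    P.level eta0 k j ≤ P.eta j := by
  rw [level_eq]
  have := sub_nonneg.2 (h.level_lt j).le
  have : 0 ≤ (P.eta j - eta0 j) / ((k : ℝ) + 1) := by positivity
  linarith

/-- Every iterate is strictly feasible for its subproblem. -/
theorem IsRun.surrogate_self_lt_level (hβ : ∀ i, 0 < β i) (h : P.IsRun β eta0 K x) {k : ℕ}
    (hk : k ≤ K) (j : Fin m) : P.surrogate β (x k) j.succ (x k) < P.level eta0 k j := by
  rw [surrogate_self]
  cases k with
  | zero => exact (psiSmooth_le_psi hβ _ _).trans_lt (h.start_strict j)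
  | succ k =>
    refine (h.psiSmooth_le_level hβ (by omega) j).trans_lt ?_
    rw [level]
    have := sub_pos.2 (h.level_lt j)
    have : 0 < (P.eta j - eta0 j) / (((k : ℝ) + 1) * ((k : ℝ) + 2)) := by positivity
    linarith

theorem IsRun.exists_isMultiplier (hβ : ∀ i, 0 < β i) (h : P.IsRun β eta0 K x) {k : ℕ}
    (hk : k ≤ K) :
    ∃ lam : Fin m → ℝ, P.IsMultiplier β (P.level eta0 k) (x k) (x (k + 1)) lam :=
  DCProblem.exists_isMultiplier (h.step k hk)
    ⟨x k, h.mem_dom (by omega), h.surrogate_self_lt_level hβ hk⟩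

/-- The centre `x k` is feasible for its own subproblem, so quadratic growth at the minimizer
applies to it; majorization then passes to the smoothed objective. -/
theorem IsRun.sufficient_decrease (hβ : ∀ i, 0 < β i) (h : P.IsRun β eta0 K x) {k : ℕ}
    (hk : k ≤ K) : P.psiSmooth β 0 (x (k + 1)) + P.Lip β 0 / 2 * ‖x (k + 1) - x k‖ ^ 2
      ≤ P.psiSmooth β 0 (x k) := by
  obtain ⟨⟨hxd, hfeas⟩, hmin⟩ := h.step k hk
  set S : Set (Vec d) :=
    {z | z ∈ P.dom ∧ ∀ j : Fin m, P.surrogate β (x k) j.succ z ≤ P.level eta0 k j} with hS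
  have hSc : Convex ℝ S := by
    intro z hz w hw a b ha hb hab
    exact ⟨(convexOn_chiReal (P := P) 0).1 hz.1 hw.1 ha hb hab, fun j =>
      ((convexOn_surrogate (P := P) (β := β) (x k) j.succ).convex_le (P.level eta0 k j)
        ⟨hz.1, hz.2 j⟩ ⟨hw.1, hw.2 j⟩ ha hb hab).2⟩
  have h1 := ((convexOn_linearized (P := P) (β := β) (x k) 0).subset (fun z hz => hz.1)
    hSc).add_sq_le_of_isMinOn_add_sq (L := P.Lip β 0) (c := x k) (x := x (k + 1)) ⟨hxd, hfeas⟩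
    (fun z hz => by
      rw [← surrogate_eq, ← surrogate_eq]
      exact hmin z hz.1 hz.2) (z := x k)
    ⟨h.mem_dom (by omega), fun j => (h.surrogate_self_lt_level hβ hk j).le⟩
  rw [← surrogate_eq, ← surrogate_eq, surrogate_self, norm_sub_rev] at h1
  exact le_trans (add_le_add_left (psiSmooth_le_surrogate hβ _ _ _) _) h1

/-- Summation by parts. Monotonicity, carried in the same induction, gives `ψ (x 0) ≥ ψ (x n)` for
the smoothed objective, which turns weight `n` into `n + 1`. -/
theorem IsRun.sum_weighted_sq_le (hβ : ∀ i, 0 < β i) (h : P.IsRun β eta0 K x) {n : ℕ}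
    (hn : n ≤ K + 1) : P.psiSmooth β 0 (x n) ≤ P.psiSmooth β 0 (x 0) ∧
      ∑ k ∈ Finset.range n, ((k : ℝ) + 1) * (P.Lip β 0 / 2 * ‖x (k + 1) - x k‖ ^ 2)
      ≤ n * (P.psiSmooth β 0 (x 0) - P.psiSmooth β 0 (x n)) := by
  induction n with
  | zero => simp
  | succ n ih =>
    obtain ⟨h1, h2⟩ := ih (by omega)
    have h3 := h.sufficient_decrease hβ (k := n) (by omega)
    have h4 : 0 ≤ P.Lip β 0 / 2 * ‖x (n + 1) - x n‖ ^ 2 :=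
      mul_nonneg (div_nonneg (Lip_nonneg 0) two_pos.le) (sq_nonneg _)
    refine ⟨by linarith, ?_⟩
    rw [Finset.sum_range_succ]
    push_cast
    have hn0 : (0 : ℝ) ≤ n := n.cast_nonneg
    nlinarith

/-- Telescoped descent, in terms of the gap of the original objective. -/
theorem IsRun.sum_weighted_sq_le_gap (hβ : ∀ i, 0 < β i) {ν : ℝ}
    (hν : ∀ i, ν = β i * P.D i ^ 2 / 2) (h : P.IsRun β eta0 K x) {xstar : Vec d}
    (hstar : P.IsOptimalSmoothed β xstar) :
    ∑ k ∈ Finset.range (K + 1), ((k : ℝ) + 1) * (P.Lip β 0 / 2 * ‖x (k + 1) - x k‖ ^ 2)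
      ≤ ((K : ℝ) + 1) * (P.psi 0 (x 0) - P.psi 0 xstar + ν) := by
  refine (h.sum_weighted_sq_le hβ le_rfl).2.trans ?_
  push_cast
  refine mul_le_mul_of_nonneg_left ?_ (by positivity)
  have h1 := hstar.2 (x (K + 1)) (h.mem_dom le_rfl) fun j =>
    (h.psiSmooth_le_level hβ le_rfl j).trans (h.level_le_eta K j)
  have h2 := psiSmooth_le_psi (P := P) hβ 0 (x 0)
  have h3 := psi_le_psiSmooth_add (P := P) hβ hν 0 xstar
  linarith

/-! Residuals of a single iteration. -/

theorem stationarity_le (hβ : ∀ i, 0 < β i) {ν : ℝ} (hν : ∀ i, ν = β i * P.D i ^ 2 / 2)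
    {lev lam : Fin m → ℝ} {xk y : Vec d} (hlam : P.IsMultiplier β lev xk y lam) :
    P.stationarity ν y lam ≤ ENNReal.ofReal
      (9 * (P.Lip β 0 + ∑ j, lam j * P.Lip β j.succ) ^ 2 * ‖y - xk‖ ^ 2) := by
  obtain ⟨hpos, hzero, -⟩ := hlam
  -- What must be added to a surrogate subgradient to get a `ν`-subgradient at `y`: the gradient
  -- change costs `2 * Lip`, the proximal term `Lip`, hence `9 = 3²` after squaring.
  set r : Fin (m + 1) → Vec d := fun i => gradient (P.fSmooth β i) y
    - gradient (P.fSmooth β i) xk - P.Lip β i • (y - xk) with hr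
  have hmem := add_mem_weightedSum hzero (T := P.psiSubdiff ν y) r (by
    rintro i _ ⟨_, rfl, c, hc, rfl⟩
    refine Set.mem_add.2 ⟨gradient (P.gSmooth β i) y + -gradient (P.h i) y,
      Set.add_mem_add (gradient_gSmooth_mem_epsSubdiff hβ hν i y) rfl, c, hc, ?_⟩
    simp only [hr, oracle, gradient_fSmooth hβ i y]
    abel)
  have hri : ∀ i, ‖r i‖ ≤ 3 * P.Lip β i * ‖y - xk‖ := by
    intro i
    have h1 := norm_gradient_fSmooth_sub_le (P := P) hβ i y xk
    have h2 := norm_sub_le (gradient (P.fSmooth β i) y - gradient (P.fSmooth β i) xk)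
      (P.Lip β i • (y - xk))
    rw [norm_smul, Real.norm_of_nonneg (Lip_nonneg i)] at h2
    simp only [hr]
    linarith
  have hnorm : ‖(0 : Vec d) + (r 0 + ∑ j, lam j • r j.succ)‖
      ≤ 3 * (P.Lip β 0 + ∑ j, lam j * P.Lip β j.succ) * ‖y - xk‖ := by
    rw [zero_add]
    refine (norm_add_le _ _).trans ?_
    have h1 : ‖∑ j, lam j • r j.succ‖ ≤ ∑ j, lam j * (3 * P.Lip β j.succ * ‖y - xk‖) := by
      refine norm_sum_le_of_le _ fun j _ => ?_
      rw [norm_smul, Real.norm_of_nonneg (hpos j)]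
      exact mul_le_mul_of_nonneg_left (hri _) (hpos j)
    have h2 : ∑ j, lam j * (3 * P.Lip β j.succ * ‖y - xk‖)
        = 3 * (∑ j, lam j * P.Lip β j.succ) * ‖y - xk‖ := by
      rw [Finset.mul_sum, Finset.sum_mul]
      exact Finset.sum_congr rfl fun j _ => by ring
    have h3 := hri 0
    linarith
  have hdist := Metric.infEDist_le_edist_of_mem (x := 0) hmem
  rw [edist_comm, edist_dist, dist_zero_right] at hdist
  unfold stationarity
  refine (pow_le_pow_left₀ zero_le hdist 2).trans ?_
  rw [← ENNReal.ofReal_pow (norm_nonneg _)]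
  refine ENNReal.ofReal_le_ofReal ((pow_le_pow_left₀ (norm_nonneg _) hnorm 2).trans ?_)
  exact le_of_eq (by ring)

/-- A positive multiplier makes the surrogate equal to the level; the three terms are then the
smoothing gap, the surrogate gap and the distance from level to `eta`. -/
theorem IsRun.complementarity_le (hβ : ∀ i, 0 < β i) {ν : ℝ}
    (hν : ∀ i, ν = β i * P.D i ^ 2 / 2) (h : P.IsRun β eta0 K x) {k : ℕ} {lam : Fin m → ℝ}
    (hlam : P.IsMultiplier β (P.level eta0 k) (x k) (x (k + 1)) lam) (j : Fin m) :
    lam j * |P.psi j.succ (x (k + 1)) - P.eta j|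
      ≤ lam j * (ν + 3 / 2 * P.Lip β j.succ * ‖x (k + 1) - x k‖ ^ 2
        + (P.eta j - eta0 j) / ((k : ℝ) + 1)) := by
  have h0 := hlam.1 j
  rcases h0.eq_or_lt with h0 | h0
  · simp [← h0]
  have h1 : P.surrogate β (x k) j.succ (x (k + 1)) = P.level eta0 k j :=
    sub_eq_zero.1 ((mul_eq_zero.1 (hlam.2.2 j)).resolve_left h0.ne')
  refine mul_le_mul_of_nonneg_left ?_ h0.le
  have h2 := psiSmooth_le_surrogate (P := P) hβ j.succ (x k) (x (k + 1))
  have h3 := surrogate_le_psiSmooth_add (P := P) hβ j.succ (x k) (x (k + 1))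
  have h4 := psiSmooth_le_psi (P := P) hβ j.succ (x (k + 1))
  have h5 := psi_le_psiSmooth_add (P := P) hβ hν j.succ (x (k + 1))
  have h6 : 0 ≤ P.Lip β j.succ * ‖x (k + 1) - x k‖ ^ 2 :=
    mul_nonneg (Lip_nonneg _) (sq_nonneg _)
  rw [level_eq] at h1
  have h7 : 0 ≤ (P.eta j - eta0 j) / ((k : ℝ) + 1) :=
    div_nonneg (sub_nonneg.2 (h.level_lt j).le) (by positivity)
  rw [abs_le]
  constructor <;> linarith

theorem IsRun.infeasibility_le (hβ : ∀ i, 0 < β i) {ν : ℝ}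
    (hν : ∀ i, ν = β i * P.D i ^ 2 / 2) (h : P.IsRun β eta0 K x) {k : ℕ} (hk : k ≤ K)
    (j : Fin m) : max (P.psi j.succ (x (k + 1)) - P.eta j) 0 ≤ ν := by
  have h1 := psi_le_psiSmooth_add (P := P) hβ hν j.succ (x (k + 1))
  have h2 := h.psiSmooth_le_level hβ hk j
  have h3 := h.level_le_eta k j
  refine max_le (by linarith) ?_
  have h4 := psiSmooth_le_psi (P := P) hβ j.succ (x (k + 1))
  linarith

/-! Constants. -/

theorem c_nonneg (i : Fin (m + 1)) : 0 ≤ P.c i := mul_nonneg (sq_nonneg _) (sq_nonneg _)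

theorem c_succ_le_cNorm (j : Fin m) : P.c j.succ ≤ P.cNorm := by
  have := PiLp.norm_apply_le (WithLp.toLp 2 (fun j : Fin m => P.c j.succ) : Vec m) j
  exact (le_abs_self _).trans this

theorem nu_pos (hβ : ∀ i, 0 < β i) {ν : ℝ} (hν : ∀ i, ν = β i * P.D i ^ 2 / 2)
    (hc : 0 < P.c 0) : 0 < ν := by
  rw [hν 0]
  have hD : P.D 0 ≠ 0 := by
    rintro h
    simp [c, h] at hc
  have := hβ 0
  positivity

theorem norm_sq_div_eq (hβ : ∀ i, 0 < β i) {ν : ℝ} (hν : ∀ i, ν = β i * P.D i ^ 2 / 2)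
    (hν0 : 0 < ν) (i : Fin (m + 1)) : ‖P.A i‖ ^ 2 / β i = P.c i / (2 * ν) := by
  have := hβ i
  rw [div_eq_div_iff this.ne' (by positivity), c]
  nth_rewrite 1 [hν i]
  ring

theorem Lip_le (hβ : ∀ i, 0 < β i) {ν κ : ℝ} (hκ : 0 < κ)
    (hν : ∀ i, ν = β i * P.D i ^ 2 / 2) (hν0 : 0 < ν) (hL : ∀ i, ν * P.Lh i ≤ κ * P.c i)
    (i : Fin (m + 1)) : P.Lip β i ≤ (κ + 1) / ν * P.c i := by
  have hc := c_nonneg (P := P) i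
  refine max_le ?_ ?_
  · rw [norm_sq_div_eq hβ hν hν0, div_mul_eq_mul_div, div_le_div_iff₀ (by positivity) hν0]
    nlinarith [mul_nonneg hc hν0.le, mul_nonneg (mul_nonneg hc hν0.le) hκ.le]
  · rw [div_mul_eq_mul_div, le_div_iff₀ hν0]
    linarith [hL i]

theorem le_Lip_zero (hβ : ∀ i, 0 < β i) {ν : ℝ}
    (hν : ∀ i, ν = β i * P.D i ^ 2 / 2) (hν0 : 0 < ν) : P.c 0 / (2 * ν) ≤ P.Lip β 0 := by
  rw [← norm_sq_div_eq hβ hν hν0]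
  exact norm_sq_div_le_Lip 0

end DCProblem

/-! ### Expectation over the random index. -/

theorem Fin.sum_val_add_one (K : ℕ) :
    ∑ j : Fin (K + 1), ((j : ℝ) + 1) = ((K : ℝ) + 1) * ((K : ℝ) + 2) / 2 := by
  rw [Fin.sum_univ_eq_sum_range (fun j => (j : ℝ) + 1) (K + 1)]
  induction K with
  | zero => norm_num
  | succ K ih =>
    rw [Finset.sum_range_succ, ih]
    push_cast
    ring

/-- Expectation bound for a function of the random index. -/
theorem IsRandomIndex.lintegral_le {Ω : Type*} [MeasurableSpace Ω] {μ : Measure Ω} {K : ℕ}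
    {khat : Ω → Fin (K + 1)} (h : IsRandomIndex μ K khat) {F : Fin (K + 1) → ℝ≥0∞} {f : ℕ → ℝ}
    {b : ℝ} (hf : ∀ k, 0 ≤ f k) (hF : ∀ k : Fin (K + 1), F k ≤ ENNReal.ofReal (f k))
    (hb : ∑ k ∈ Finset.range (K + 1), ((k : ℝ) + 1) * f k
      ≤ ((K : ℝ) + 1) * ((K : ℝ) + 2) / 2 * b) :
    ∫⁻ ω, F (khat ω) ∂μ ≤ ENNReal.ofReal b := by
  have h1 : ∫⁻ ω, F (khat ω) ∂μ = ∑ k, F k * μ (khat ⁻¹' {k}) := by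
    rw [← lintegral_map (Measurable.of_discrete (f := F)) h.1, lintegral_fintype]
    exact Finset.sum_congr rfl fun k _ => by rw [Measure.map_apply h.1 (measurableSet_singleton k)]
  have hS : 0 < ((K : ℝ) + 1) * ((K : ℝ) + 2) / 2 := by positivity
  rw [h1]
  calc ∑ k, F k * μ (khat ⁻¹' {k})
      ≤ ∑ k : Fin (K + 1), ENNReal.ofReal
          (((k : ℝ) + 1) * f k / (((K : ℝ) + 1) * ((K : ℝ) + 2) / 2)) := by
        refine Finset.sum_le_sum fun k _ => ?_
        rw [h.2 k, Fin.sum_val_add_one]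
        refine (mul_le_mul_left (hF k) _).trans ?_
        rw [← ENNReal.ofReal_mul (hf k)]
        exact ENNReal.ofReal_le_ofReal (le_of_eq (by ring))
    _ = ENNReal.ofReal (∑ k : Fin (K + 1),
          ((k : ℝ) + 1) * f k / (((K : ℝ) + 1) * ((K : ℝ) + 2) / 2)) := by
        rw [ENNReal.ofReal_sum_of_nonneg]
        intro k _
        have := hf k
        positivity
    _ ≤ ENNReal.ofReal b := by
        refine ENNReal.ofReal_le_ofReal ?_
        rw [← Finset.sum_div, div_le_iff₀ hS,
          Fin.sum_univ_eq_sum_range (fun k => ((k : ℝ) + 1) * f k) (K + 1)]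
        linarith

/-! ### Assembly of the rate and choice of parameters. -/

namespace DCProblem

variable {d m : ℕ} {P : DCProblem d m} {β : Fin (m + 1) → ℝ} {eta0 : Fin m → ℝ} {K : ℕ}
  {x : ℕ → Vec d}

theorem IsRandomizedTypeIII.mono {Ω : Type*} [MeasurableSpace Ω] {μ : Measure Ω} {X : Ω → Vec d}
    {ε ε' ν : ℝ} (h : P.IsRandomizedTypeIII μ X ε ν) (hε : ε ≤ ε') :
    P.IsRandomizedTypeIII μ X ε' ν := by
  obtain ⟨Lam, h1, h2, h3, h4, h5, h6, h7, h8, h9⟩ := h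
  have := ENNReal.ofReal_le_ofReal hε
  exact ⟨Lam, h1, h2, h3, h4, h5, h6, h7.trans this, h8.trans this, h9.trans this⟩

theorem cNorm_nonneg : 0 ≤ P.cNorm := norm_nonneg _

theorem BoundedMultipliers.nonneg {lam : ℕ → Fin m → ℝ} {B : ℝ}
    (h : P.BoundedMultipliers β eta0 K x lam B) : 0 ≤ B :=
  (Finset.sum_nonneg fun _ _ => abs_nonneg _).trans (h 0 K.zero_le).2

theorem BoundedMultipliers.sum_mul_le {lam : ℕ → Fin m → ℝ} {B : ℝ}
    (h : P.BoundedMultipliers β eta0 K x lam B) {k : ℕ} (hk : k ≤ K) {a : Fin m → ℝ} {b : ℝ}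
    (hb : 0 ≤ b) (hab : ∀ j, a j ≤ b) : ∑ j, lam (k + 1) j * a j ≤ B * b := by
  calc ∑ j, lam (k + 1) j * a j ≤ ∑ j, |lam (k + 1) j| * b :=
        Finset.sum_le_sum fun j _ => (mul_le_mul_of_nonneg_left (hab j) ((h k hk).1.1 j)).trans
          (mul_le_mul_of_nonneg_right (le_abs_self _) hb)
    _ = (∑ j, |lam (k + 1) j|) * b := by rw [Finset.sum_mul]
    _ ≤ B * b := mul_le_mul_of_nonneg_right (h k hk).2 hb

theorem isRandomizedTypeIII_of_run {κ ν : ℝ} (hκ : 0 < κ) (hc : 0 < P.c 0) (hβ : ∀ i, 0 < β i)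
    (hν : ∀ i, ν = β i * P.D i ^ 2 / 2) (hL : ∀ i, ν * P.Lh i ≤ κ * P.c i)
    (hrun : P.IsRun β eta0 K x) {lam : ℕ → Fin m → ℝ} {B : ℝ} {xstar : Vec d}
    (hlam : P.BoundedMultipliers β eta0 K x lam B) (hstar : P.IsOptimalSmoothed β xstar)
    {Ω : Type*} [MeasurableSpace Ω] {μ : Measure Ω} {khat : Ω → Fin (K + 1)}
    (hk : IsRandomIndex μ K khat) :
    P.IsRandomizedTypeIII μ (fun ω => x ((khat ω : ℕ) + 1))
      (9 * (κ + 1) ^ 2 * P.rate eta0 K ν B (P.psi 0 (x 0) - P.psi 0 xstar)) ν := by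
  have hν0 := nu_pos hβ hν hc
  have hB := hlam.nonneg
  have hcN := cNorm_nonneg (P := P)
  set N : ℝ := ‖(WithLp.toLp 2 (fun j => P.eta j - eta0 j) : Vec m)‖ with hN
  have hN0 : 0 ≤ N := norm_nonneg _
  have hetaN : ∀ j, P.eta j - eta0 j ≤ N := fun j =>
    (le_abs_self _).trans
      (PiLp.norm_apply_le (WithLp.toLp 2 (fun j => P.eta j - eta0 j) : Vec m) j)
  set M : ℝ := κ + 1 with hM
  have hM1 : 1 ≤ M := by linarith
  set Δ : ℝ := P.psi 0 (x 0) - P.psi 0 xstar with hΔ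
  set R : ℕ → ℝ := fun k => ‖x (k + 1) - x k‖ ^ 2 with hR
  have hR0 : ∀ k, 0 ≤ R k := fun k => sq_nonneg _
  set T : ℝ := (K : ℝ) + 1 with hT
  have hT0 : 0 < T := by positivity
  have hgap : ∑ k ∈ Finset.range (K + 1), ((k : ℝ) + 1) * R k
      ≤ 4 * ν / P.c 0 * (T * (Δ + ν)) := by
    have h1 := hrun.sum_weighted_sq_le_gap hβ hν hstar
    have h2 := le_Lip_zero (P := P) hβ hν hν0
    have h3 : P.c 0 / (4 * ν) * ∑ k ∈ Finset.range (K + 1), ((k : ℝ) + 1) * R k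
        ≤ T * (Δ + ν) := by
      refine le_trans ?_ h1
      rw [Finset.mul_sum]
      refine Finset.sum_le_sum fun k _ => ?_
      have h4 : P.c 0 / (4 * ν) ≤ P.Lip β 0 / 2 := by
        have : P.c 0 / (4 * ν) = P.c 0 / (2 * ν) / 2 := by field_simp; norm_num
        linarith
      have h5 : 0 ≤ ((k : ℝ) + 1) * R k := mul_nonneg (by positivity) (hR0 k)
      calc P.c 0 / (4 * ν) * (((k : ℝ) + 1) * R k)
          ≤ P.Lip β 0 / 2 * (((k : ℝ) + 1) * R k) := mul_le_mul_of_nonneg_right h4 h5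
        _ = ((k : ℝ) + 1) * (P.Lip β 0 / 2 * ‖x (k + 1) - x k‖ ^ 2) := by rw [hR]; ring
    calc ∑ k ∈ Finset.range (K + 1), ((k : ℝ) + 1) * R k
        = 4 * ν / P.c 0
          * (P.c 0 / (4 * ν) * ∑ k ∈ Finset.range (K + 1), ((k : ℝ) + 1) * R k) := by
          field_simp
      _ ≤ _ := mul_le_mul_of_nonneg_left h3 (by positivity)
  -- `Δ` alone may be negative, since `xstar` is optimal only for the smoothed problem;
  -- nonnegativity of `Δ + ν` is read off from `hgap`.
  have hG0 : 0 ≤ T * (Δ + ν) := by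
    have h1 : 0 ≤ 4 * ν / P.c 0 * (T * (Δ + ν)) :=
      (Finset.sum_nonneg fun k _ => mul_nonneg (by positivity) (hR0 k)).trans hgap
    exact nonneg_of_mul_nonneg_right h1 (by positivity)
  set Q : ℝ := P.c 0 + B * P.cNorm with hQ
  set S : ℝ := ((K : ℝ) + 1) * ((K : ℝ) + 2) / 2 with hS
  have hS0 : 0 < S := by positivity
  -- `S` is the total weight; multiplying by it turns `2 / (K + 2)` into `T = K + 1`.
  have hrate : S * P.rate eta0 K ν B Δ = 8 * Q ^ 2 / (P.c 0 * ν) * (T * (Δ + ν))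
      + 2 * B * P.cNorm / P.c 0 * (T * (Δ + ν)) + B * N * T + S * (B * ν) + S * (m * ν) := by
    have : S * (2 / ((K : ℝ) + 2)) = T := by rw [hS, hT]; field_simp
    unfold rate
    rw [← hN, ← hQ]
    linear_combination ((8 * Q ^ 2 / (P.c 0 * ν) + 2 * B * P.cNorm / P.c 0) * (Δ + ν) + B * N)
      * this
  have hLip := fun i => Lip_le (P := P) hβ hκ hν hν0 hL i
  have hLipN : ∀ j : Fin m, P.Lip β j.succ ≤ M / ν * P.cNorm := fun j =>
    (hLip j.succ).trans (mul_le_mul_of_nonneg_left (c_succ_le_cNorm j) (by positivity))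
  have hsum1 : ∑ k ∈ Finset.range (K + 1), ((k : ℝ) + 1) = S := by
    rw [hS, ← Fin.sum_val_add_one, Fin.sum_univ_eq_sum_range (fun j => (j : ℝ) + 1) (K + 1)]
  have hP1 : 0 ≤ 8 * Q ^ 2 / (P.c 0 * ν) * (T * (Δ + ν)) := mul_nonneg (by positivity) hG0
  have hP2 : 0 ≤ 2 * B * P.cNorm / P.c 0 * (T * (Δ + ν)) := mul_nonneg (by positivity) hG0
  have hP3 : 0 ≤ B * N * T := by positivity
  have hP4 : 0 ≤ S * (B * ν) := by positivity
  have hP5 : 0 ≤ S * (m * ν) := by positivity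
  have hMM : M ≤ M ^ 2 := by nlinarith
  have hM2 : 1 ≤ M ^ 2 := hM1.trans hMM
  refine ⟨fun ω => lam ((khat ω : ℕ) + 1),
    (Measurable.of_discrete (f := fun k : Fin (K + 1) => x ((k : ℕ) + 1))).comp hk.1,
    (Measurable.of_discrete (f := fun k : Fin (K + 1) => lam ((k : ℕ) + 1))).comp hk.1,
    fun ω j => (hlam _ (Nat.lt_succ_iff.1 (khat ω).2)).1.1 j,
    (Measurable.of_discrete (f := fun k : Fin (K + 1) =>
      P.stationarity ν (x ((k : ℕ) + 1)) (lam ((k : ℕ) + 1)))).comp hk.1,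
    (Measurable.of_discrete (f := fun k : Fin (K + 1) => ∑ j : Fin m,
      lam ((k : ℕ) + 1) j * |P.psi j.succ (x ((k : ℕ) + 1)) - P.eta j|)).comp hk.1,
    (Measurable.of_discrete (f := fun k : Fin (K + 1) => ∑ j : Fin m,
      max (P.psi j.succ (x ((k : ℕ) + 1)) - P.eta j) 0)).comp hk.1, ?_, ?_, ?_⟩
  · refine hk.lintegral_le
      (F := fun k => P.stationarity ν (x ((k : ℕ) + 1)) (lam ((k : ℕ) + 1)))
      (f := fun k => 9 * (M / ν * Q) ^ 2 * R k)
      (fun k => mul_nonneg (by positivity) (hR0 k)) (fun k => ?_) ?_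
    · have hkK : (k : ℕ) ≤ K := Nat.lt_succ_iff.1 k.2
      refine (stationarity_le hβ hν (hlam k hkK).1).trans (ENNReal.ofReal_le_ofReal ?_)
      refine mul_le_mul_of_nonneg_right (mul_le_mul_of_nonneg_left
        (pow_le_pow_left₀ ?_ ?_ 2) (by norm_num)) (hR0 k)
      · exact add_nonneg (Lip_nonneg 0) (Finset.sum_nonneg fun j _ =>
          mul_nonneg ((hlam k hkK).1.1 j) (Lip_nonneg _))
      · have h1 := hlam.sum_mul_le hkK (by positivity) hLipN
        have h2 := hLip 0
        rw [hQ]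
        linarith
    · have h1 : ∑ k ∈ Finset.range (K + 1), ((k : ℝ) + 1) * (9 * (M / ν * Q) ^ 2 * R k)
          = 9 * (M / ν * Q) ^ 2 * ∑ k ∈ Finset.range (K + 1), ((k : ℝ) + 1) * R k := by
        rw [Finset.mul_sum]
        exact Finset.sum_congr rfl fun k _ => by ring
      rw [h1]
      calc _ ≤ 9 * (M / ν * Q) ^ 2 * (4 * ν / P.c 0 * (T * (Δ + ν))) :=
            mul_le_mul_of_nonneg_left hgap (by positivity)
        _ = 9 / 2 * M ^ 2 * (8 * Q ^ 2 / (P.c 0 * ν) * (T * (Δ + ν))) := by field_simp; ring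
        _ ≤ 9 * M ^ 2 * (S * P.rate eta0 K ν B Δ) := by
            refine mul_le_mul (by linarith) (by linarith) hP1 (by positivity)
        _ = _ := by ring
  · refine hk.lintegral_le
      (F := fun k => ENNReal.ofReal (∑ j : Fin m,
        lam ((k : ℕ) + 1) j * |P.psi j.succ (x ((k : ℕ) + 1)) - P.eta j|))
      (f := fun k => B * (ν + 3 / 2 * (M / ν * P.cNorm) * R k + N / ((k : ℝ) + 1)))
      (fun k => ?_) (fun k => ?_) ?_
    · have := hR0 k
      positivity
    · have hkK : (k : ℕ) ≤ K := Nat.lt_succ_iff.1 k.2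
      refine ENNReal.ofReal_le_ofReal ?_
      refine (Finset.sum_le_sum fun j _ =>
        hrun.complementarity_le hβ hν (hlam k hkK).1 j).trans ?_
      refine hlam.sum_mul_le hkK ?_ fun j => ?_
      · have := hR0 k
        positivity
      · have h1 := mul_le_mul_of_nonneg_right (hLipN j) (hR0 k)
        have h2 := div_le_div_of_nonneg_right (hetaN j) (by positivity : (0 : ℝ) ≤ (k : ℕ) + 1)
        simp only [hR] at h1 ⊢
        linarith
    -- The weight `k + 1` cancels the decay `1 / (k + 1)` of the level gap, leaving `B * N` per
    -- iteration.
    · have h1 : ∑ k ∈ Finset.range (K + 1), ((k : ℝ) + 1)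
            * (B * (ν + 3 / 2 * (M / ν * P.cNorm) * R k + N / ((k : ℝ) + 1)))
          = S * (B * ν) + 3 / 2 * (B * (M / ν * P.cNorm))
            * ∑ k ∈ Finset.range (K + 1), ((k : ℝ) + 1) * R k + B * N * T := by
        rw [← hsum1, Finset.sum_mul, Finset.mul_sum, ← Finset.sum_add_distrib]
        have h2 : B * N * T = ∑ k ∈ Finset.range (K + 1), B * N := by
          rw [Finset.sum_const, Finset.card_range, nsmul_eq_mul, hT]
          push_cast
          ring
        rw [h2, ← Finset.sum_add_distrib]
        refine Finset.sum_congr rfl fun k _ => ?_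
        field_simp
      rw [h1]
      have h3 : 3 / 2 * (B * (M / ν * P.cNorm)) * ∑ k ∈ Finset.range (K + 1), ((k : ℝ) + 1) * R k
          ≤ 3 * M * (2 * B * P.cNorm / P.c 0 * (T * (Δ + ν))) := by
        calc _ ≤ 3 / 2 * (B * (M / ν * P.cNorm)) * (4 * ν / P.c 0 * (T * (Δ + ν))) :=
              mul_le_mul_of_nonneg_left hgap (by positivity)
          _ = _ := by field_simp; ring
      have h4 : S * (9 * M ^ 2 * P.rate eta0 K ν B Δ)
          = 9 * M ^ 2 * (S * P.rate eta0 K ν B Δ) := by ring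
      rw [h4, hrate]
      have h5 : 3 * M * (2 * B * P.cNorm / P.c 0 * (T * (Δ + ν)))
          ≤ 9 * M ^ 2 * (2 * B * P.cNorm / P.c 0 * (T * (Δ + ν))) :=
        mul_le_mul_of_nonneg_right (by linarith) hP2
      have h6 : S * (B * ν) + B * N * T ≤ 9 * M ^ 2 * (S * (B * ν) + B * N * T) :=
        le_mul_of_one_le_left (by linarith) (by linarith)
      have h7 : 0 ≤ 9 * M ^ 2 * (8 * Q ^ 2 / (P.c 0 * ν) * (T * (Δ + ν)) + S * (m * ν)) := by
        positivity
      linarith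
  · refine hk.lintegral_le
      (F := fun k => ENNReal.ofReal (∑ j : Fin m,
        max (P.psi j.succ (x ((k : ℕ) + 1)) - P.eta j) 0))
      (f := fun _ => m * ν) (fun k => by positivity) (fun k => ?_) ?_
    · refine ENNReal.ofReal_le_ofReal ?_
      refine (Finset.sum_le_sum fun j _ =>
        hrun.infeasibility_le hβ hν (Nat.lt_succ_iff.1 k.2) j).trans ?_
      simp
    · rw [← Finset.sum_mul, hsum1]
      calc S * (m * ν) ≤ 9 * M ^ 2 * (S * (m * ν)) := le_mul_of_one_le_left hP5 (by linarith)
        _ ≤ 9 * M ^ 2 * (S * P.rate eta0 K ν B Δ) :=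
            mul_le_mul_of_nonneg_left (by linarith) (by positivity)
        _ = _ := by ring

theorem length_queries (K : ℕ) (x : ℕ → Vec d) :
    (queries (m := m) K x).length = (K + 1) * (m + 1) := by
  simp [queries, List.length_flatMap]

/-- A uniform constant in the comparison of the curvature of `hᵢ` with `cᵢ`. -/
theorem exists_Lh_le (P : DCProblem d m) (h : ∀ i, P.c i = 0 → P.Lh i = 0) :
    ∃ κ : ℝ, 0 < κ ∧ ∀ i, P.Lh i ≤ κ * P.c i := by
  have h0 : ∀ i, 0 ≤ P.Lh i / P.c i := fun i => div_nonneg (P.Lh_nonneg i) (c_nonneg i)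
  refine ⟨1 + ∑ i, P.Lh i / P.c i, by
    have := Finset.sum_nonneg fun i (_ : i ∈ Finset.univ) => h0 i
    linarith, fun i => ?_⟩
  rcases (c_nonneg (P := P) i).eq_or_lt with hc | hc
  · rw [h i hc.symm, ← hc, mul_zero]
  · rw [← div_le_iff₀ hc]
    have := Finset.single_le_sum (fun i _ => h0 i) (Finset.mem_univ i)
    linarith

/-- The choice of `ν` and `K` that makes the rate at most `ε`. -/
theorem exists_rate_le (P : DCProblem d m) (eta0 : Fin m → ℝ) {B Δbar C : ℝ} (hc : 0 < P.c 0)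
    (hB : 0 ≤ B) (hΔ : 0 ≤ Δbar) (hC : 0 < C) :
    ∃ C' : ℝ, 0 < C' ∧ ∀ ε : ℝ, 0 < ε → ε ≤ 1 → ∃ (ν : ℝ) (K : ℕ), 0 < ν ∧ ν ≤ ε ∧
      ((K : ℝ) + 1) * ((m : ℝ) + 1) ≤ C' / ε ^ 2 ∧
      ∀ Δ ≤ Δbar, C * P.rate eta0 K ν B Δ ≤ ε := by
  have hcN := cNorm_nonneg (P := P)
  set N : ℝ := ‖(WithLp.toLp 2 (fun j => P.eta j - eta0 j) : Vec m)‖ with hN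
  have hN0 : 0 ≤ N := norm_nonneg _
  -- With `ν = ε / W` the terms of the rate not divided by `K + 2` use at most `ε / 2`; the `+ 1`
  -- ensures `ν ≤ ε`.
  set W : ℝ := 2 * C * (B + m) + 1 with hW
  have hW1 : 1 ≤ W := by
    have : 0 ≤ 2 * C * (B + m) := by positivity
    linarith
  set Q : ℝ := (8 * (P.c 0 + B * P.cNorm) ^ 2 * W / P.c 0 + 2 * B * P.cNorm / P.c 0) * (Δbar + 1)
    + B * N with hQ
  have hQ0 : 0 ≤ Q := by positivity
  refine ⟨(4 * C * Q + 2) * (m + 1), by positivity, fun ε hε hε1 => ?_⟩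
  have hW0 : 0 < W := by linarith
  have hνε : ε / W ≤ ε := div_le_self hε.le hW1
  set ν : ℝ := ε / W with hν
  have hν0 : 0 < ν := by positivity
  -- The bracket in the rate is at most `Q / ε`, so this `K` brings its contribution below `ε / 2`.
  refine ⟨ν, ⌈4 * C * Q / ε ^ 2⌉₊, hν0, hνε, ?_, fun Δ hΔ' => ?_⟩
  · have h1 := (Nat.ceil_lt_add_one (by positivity : 0 ≤ 4 * C * Q / ε ^ 2)).le
    have h2 : 1 ≤ 1 / ε ^ 2 := by
      rw [le_div_iff₀ (by positivity)]
      nlinarith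
    have h3 : (4 * C * Q + 2) * (m + 1) / ε ^ 2
        = (4 * C * Q / ε ^ 2 + 2 * (1 / ε ^ 2)) * ((m : ℝ) + 1) := by ring
    rw [h3]
    exact mul_le_mul_of_nonneg_right (by linarith) (by positivity)
  · set K : ℕ := ⌈4 * C * Q / ε ^ 2⌉₊ with hK
    have hK1 : 4 * C * Q / ε ^ 2 ≤ (K : ℝ) + 2 := by
      have := Nat.le_ceil (4 * C * Q / ε ^ 2)
      linarith
    have h1 : (8 * (P.c 0 + B * P.cNorm) ^ 2 / (P.c 0 * ν) + 2 * B * P.cNorm / P.c 0) * (Δ + ν)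
        + B * N ≤ Q / ε := by
      have h2 : 8 * (P.c 0 + B * P.cNorm) ^ 2 / (P.c 0 * ν)
          = 8 * (P.c 0 + B * P.cNorm) ^ 2 * W / P.c 0 / ε := by
        rw [hν]; field_simp
      have hle : ∀ a : ℝ, 0 ≤ a → a ≤ a / ε := fun a ha => le_div_self ha hε hε1
      have h3 : 8 * (P.c 0 + B * P.cNorm) ^ 2 / (P.c 0 * ν) + 2 * B * P.cNorm / P.c 0
          ≤ (8 * (P.c 0 + B * P.cNorm) ^ 2 * W / P.c 0 + 2 * B * P.cNorm / P.c 0) / ε := by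
        rw [add_div, h2]
        exact add_le_add_right (hle _ (by positivity)) _
      calc _ ≤ (8 * (P.c 0 + B * P.cNorm) ^ 2 / (P.c 0 * ν) + 2 * B * P.cNorm / P.c 0)
              * (Δbar + 1) + B * N := by
            have : 0 ≤ 8 * (P.c 0 + B * P.cNorm) ^ 2 / (P.c 0 * ν) + 2 * B * P.cNorm / P.c 0 := by
              positivity
            have := mul_le_mul_of_nonneg_left (by linarith : Δ + ν ≤ Δbar + 1) this
            linarith
        _ ≤ (8 * (P.c 0 + B * P.cNorm) ^ 2 * W / P.c 0 + 2 * B * P.cNorm / P.c 0) / ε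
              * (Δbar + 1) + B * N / ε :=
            add_le_add (mul_le_mul_of_nonneg_right h3 (by linarith)) (hle _ (by positivity))
        _ = Q / ε := by rw [hQ]; ring
    have h4 : C * (2 / ((K : ℝ) + 2) * (Q / ε)) ≤ ε / 2 := by
      have h5 : C * (2 / ((K : ℝ) + 2) * (Q / ε)) = 2 * C * Q / ε / ((K : ℝ) + 2) := by
        ring
      rw [h5, div_le_iff₀ (by positivity)]
      calc 2 * C * Q / ε = ε / 2 * (4 * C * Q / ε ^ 2) := by field_simp; ring
        _ ≤ _ := mul_le_mul_of_nonneg_left hK1 (by positivity)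
    have h6 : C * (B * ν + m * ν) ≤ ε / 2 := by
      have h7 : W * ν = ε := by rw [hν]; field_simp
      have h8 : W * ν = 2 * (C * (B * ν + m * ν)) + ν := by rw [hW]; ring
      linarith
    have h9 : C * (2 / ((K : ℝ) + 2) * ((8 * (P.c 0 + B * P.cNorm) ^ 2 / (P.c 0 * ν)
        + 2 * B * P.cNorm / P.c 0) * (Δ + ν) + B * N)) ≤ C * (2 / ((K : ℝ) + 2) * (Q / ε)) :=
      mul_le_mul_of_nonneg_left (mul_le_mul_of_nonneg_left h1 (by positivity)) hC.le
    unfold rate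
    rw [← hN]
    linarith

end DCProblem

theorem mainTheorem7 :
    -- existence of the multipliers, and the rate
    (∀ κ : ℝ, 0 < κ → ∃ C : ℝ, 0 < C ∧
      ∀ (d m : ℕ) (P : DCProblem d m) (β : Fin (m + 1) → ℝ) (ν : ℝ) (eta0 : Fin m → ℝ) (K : ℕ)
        (x : ℕ → Vec d),
        0 < P.c 0 → (∀ i, 0 < β i) → (∀ i, ν = β i * P.D i ^ 2 / 2) →
        (∀ i, ν * P.Lh i ≤ κ * P.c i) →
        P.IsRun β eta0 K x →
        (∀ k ≤ K, ∃ lam : Fin m → ℝ,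
          P.IsMultiplier β (P.level eta0 k) (x k) (x (k + 1)) lam) ∧
        ∀ (lam : ℕ → Fin m → ℝ) (B : ℝ) (xstar : Vec d),
          P.BoundedMultipliers β eta0 K x lam B →
          P.IsOptimalSmoothed β xstar →
          ∀ (Ω : Type*) [MeasurableSpace Ω] (μ : Measure Ω) [IsProbabilityMeasure μ]
            (khat : Ω → Fin (K + 1)), IsRandomIndex μ K khat →
            P.IsRandomizedTypeIII μ (fun ω => x ((khat ω : ℕ) + 1))
              (C * P.rate eta0 K ν B (P.psi 0 (x 0) - P.psi 0 xstar)) ν) ∧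
    -- the gradient complexity
    (∀ (d m : ℕ) (P : DCProblem d m) (eta0 : Fin m → ℝ) (B Δbar : ℝ),
        0 < P.c 0 → (∀ i, P.c i = 0 → P.Lh i = 0) → 0 ≤ B → 0 ≤ Δbar →
        ∃ C ε₀ : ℝ, 0 < C ∧ 0 < ε₀ ∧ ∀ ε : ℝ, 0 < ε → ε ≤ ε₀ →
          ∃ (ν : ℝ) (K : ℕ), 0 < ν ∧ ν ≤ ε ∧
            (∀ x : ℕ → Vec d,
              ((DCProblem.queries (m := m) K x).length : ℝ) ≤ C / ε ^ 2) ∧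
            ∀ (β : Fin (m + 1) → ℝ) (x : ℕ → Vec d) (lam : ℕ → Fin m → ℝ) (xstar : Vec d),
              (∀ i, 0 < β i) → (∀ i, ν = β i * P.D i ^ 2 / 2) →
              P.IsRun β eta0 K x →
              P.BoundedMultipliers β eta0 K x lam B →
              P.IsOptimalSmoothed β xstar →
              P.psi 0 (x 0) - P.psi 0 xstar ≤ Δbar →
              ∀ (Ω : Type*) [MeasurableSpace Ω] (μ : Measure Ω) [IsProbabilityMeasure μ]
                (khat : Ω → Fin (K + 1)), IsRandomIndex μ K khat →
                P.IsRandomizedTypeIII μ (fun ω => x ((khat ω : ℕ) + 1)) ε ν) := by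
  refine ⟨fun κ hκ => ⟨9 * (κ + 1) ^ 2, by positivity, ?_⟩, ?_⟩
  · intro d m P β ν eta0 K x hc hβ hν hL hrun
    refine ⟨fun k hk => hrun.exists_isMultiplier hβ hk, ?_⟩
    intro lam B xstar hlam hstar Ω _ μ _ khat hkhat
    exact DCProblem.isRandomizedTypeIII_of_run hκ hc hβ hν hL hrun hlam hstar hkhat
  · intro d m P eta0 B Δbar hc hcL hB hΔ
    obtain ⟨κ, hκ, hκL⟩ := P.exists_Lh_le hcL
    obtain ⟨C', hC', h⟩ := P.exists_rate_le eta0 hc hB hΔ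
      (by positivity : 0 < 9 * (κ + 1) ^ 2)
    refine ⟨C', 1, hC', one_pos, fun ε hε hε1 => ?_⟩
    obtain ⟨ν, K, hν0, hνε, hq, hrate⟩ := h ε hε hε1
    refine ⟨ν, K, hν0, hνε, fun x => ?_, ?_⟩
    · rw [DCProblem.length_queries]
      push_cast
      exact hq
    · intro β x lam xstar hβ hν hrun hlam hstar hgap Ω _ μ _ khat hkhat
      refine (DCProblem.isRandomizedTypeIII_of_run hκ hc hβ hν (fun i => ?_) hrun hlam hstar
        hkhat).mono (hrate _ hgap)
      -- The threshold `1` for `ε` gives `ν ≤ 1`, so a `κ` independent of `ε` suffices.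
      exact (mul_le_of_le_one_left (P.Lh_nonneg i) (hνε.trans hε1)).trans (hκL i)
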